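/- **Setting.** A transportation network has nodes $\mathcal M=\{1,\dots,m\}$. Riders for the origin–destination pair $(i,j)$ have potential arrival rate $\lambda_{ij}\ge 0$, with $\lambda_{ii}=0$; $F$ is the cumulative distribution function of their willingness to pay, which lies in $[0,\ell_{\max}]$. Vehicles have energy levels $\mathcal V=\{0,1,\dots,v_{\max}\}$, $v_{\max}\ge1$. A trip from $i$ to $j\neq i$ takes $\tau_{ij}\ge 1$ periods and $v_{ij}\in\mathbb N$ units of energy. Being "routed" from $i$ to $i$ means staying idle; it takes one period ($\tau_{ii}:=1$ here) and no energy ($v_{ii}=0$). Charging one unit takes one period. A *feasible static solution* consists of prices $\tilde\ell_{ij}\in\mathbb R$ and flows $\tilde x_{ij}^v,\tilde x_{ic}^v\ge 0$ ($v\in\mathbb Z$), zero for $v\notin\mathcal V$, such that $\tilde x_{ic}^{v_{\max}}=0$, $\tilde x_{ij}^v=0$ for $v<v_{ij}$, and $$\lambda_{ij}(1-F(\tilde\ell_{ij}))\le\sum_{v=v_{ij}}^{v_{\max}}\tilde x_{ij}^v,\qquad \tilde x_{ic}^v+\sum_j\tilde x_{ij}^v=\tilde x_{ic}^{v-1}+\sum_j\tilde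 x_{ji}^{v+v_{ji}}\qquad(i,j\in\mathcal M,\ v\in\mathcal V).$$ **Dynamics.** A fleet of $N$ vehicles starts in some state: each vehicle is at a node or on its way to one, with a known energy level in $\mathcal V$ upon arrival, and the queues $q_{ij}(0)\in\mathbb N$ are given. In each period $t=0,1,2,\dots$, every vehicle at a node $i$ with energy $v$ is, independently, routed to $j$ with probability $\alpha_{ij}^v$ or charged with probability $\alpha_{ic}^v$, where $\alpha_{ic}^v+\sum_j\alpha_{ij}^v=1$, $\alpha_{ic}^{v_{\max}}=0$, and $\alpha_{ij}^v=0$ for $v<v_{ij}$. A charged vehicle is at $i$ with energy $v+1$ one period later; a vehicle routed to $j$ is at $j$ with energy $v-v_{ij}$ after $\tau_{ij}$ periods. Let $x_{ij}(t)$ be the number of vehicles routed from $i$ to $j$ in period $t$. Independently, the numbers of new requests $A_{ij}(t)$ are independent with law $\mathrm{Pois}(\lambda_{ij}(1-F(\ell_{ij}(t))))$, where $\ell_{ij}(t)$ are the prices charged, and $q_{ij}(t+1)=\max\{q_{ij}(t)+A_{ij}(t)-x_{ij}(t),0\}$. The system is *stable* if almost surely $q_{ij}(t)/t\to0$ for all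 $i,j$. **Fleet.** Call a finite set $C$ of pairs $(i,v)$ *closed* if $(i,v)\in C$ and $\tilde x_{ic}^v>0$ imply $(i,v+1)\in C$, and $(i,v)\in C$ and $\tilde x_{ij}^v>0$ imply $(j,v-v_{ij})\in C$. Put $S(C)=\sum_{(i,v)\in C}\bigl(\tilde x_{ic}^v+\sum_j\tau_{ij}\tilde x_{ij}^v\bigr)$, the number of vehicles that the static flow keeps occupied in $C$. Let $n(C)$ be the number of vehicles that are initially at, or on their way to, a node $i$ with energy $v$ (upon arrival), $(i,v)\in C$. The initial fleet *matches* the static solution if $n(C)=S(C)$ for all closed $C$, and *covers* it if $n(C)\ge S(C)$ for all closed $C$. **Corollary 1.1 (to Proposition 1).** Let $\{\tilde\ell_{ij},\tilde x_{ij}^v,\tilde x_{ic}^v\}$ be a feasible static solution. Consider a policy with constant prices $\ell_{ij}(t)=\tilde\ell_{ij}$ and constant probabilities $\alpha$ such that $$\alpha_{ij}^v=\frac{\tilde x_{ij}^v}{\sum_{k}\tilde x_{ik}^v+\tilde x_{ic}^v},\qquad \alpha_{ic}^v=\frac{\tilde x_{ic}^v}{\sum_{k}\tilde x_{ik}^v+\tilde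 x_{ic}^v}$$ for all $i\in\mathcal M$, $v\in\mathcal V$ for which the denominator is not $0$ (at other $(i,v)$ they are arbitrary). Such a policy exists, some initial fleet covers the static solution, and, for each such policy, each $N$ and each initial state: 1. If the initial fleet matches the static solution, then the policy meets the time-average criteria of Proposition 1: almost surely, for all $i,j$, $$\lim_{T\to\infty}\frac1T\sum_{t<T}A_{ij}(t)=\lambda_{ij}(1-F(\tilde\ell_{ij})),\qquad \lim_{T\to\infty}\frac1T\sum_{t<T}x_{ij}(t)=\sum_{v=v_{ij}}^{v_{\max}}\tilde x_{ij}^v ,$$ and the system is stable. 2. If the initial fleet covers the static solution, then the system is stable. -/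

import Mathlib

open MeasureTheory ProbabilityTheory Filter Topology

/-! ### The network and the static problem -/

/-- Data of a transportation network with `m` nodes, served by electric vehicles, in a
time-invariant environment. Energy levels are the integers `0, …, vmax`. Remaining at a node
(the pair `(i, i)`) takes one period and no energy, and there is no demand from `i` to `i`. -/
structure Network (m : ℕ) where
  /-- arrival rate of potential riders for each origin-destination pair -/
  lam : Fin m → Fin m → ℝ
  lam_nonneg : ∀ i j, 0 ≤ lam i j
  lam_self : ∀ i, lam i i = 0
  /-- number of periods that a trip takes -/
  tau : Fin m → Fin m → ℕ
  tau_pos : ∀ i j, i ≠ j → 1 ≤ tau i j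
  /-- energy that a trip consumes -/
  energyUse : Fin m → Fin m → ℕ
  energyUse_self : ∀ i, energyUse i i = 0
  /-- battery capacity -/
  vmax : ℕ
  vmax_pos : 0 < vmax
  /-- maximal willingness to pay -/
  lmax : ℝ
  /-- law of the riders' willingness to pay, carried by `[0, lmax]` -/
  willingness : Measure ℝ
  isProb : IsProbabilityMeasure willingness
  willingness_support : ∀ᵐ w ∂willingness, w ∈ Set.Icc 0 lmax

namespace Network

variable {m : ℕ} (G : Network m)

/-- The induced arrival rate `λ_ij (1 - F(p))`, where `F` is the distribution function of the
willingness to pay. -/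
noncomputable def inducedRate (i j : Fin m) (p : ℝ) : ℝ :=
  G.lam i j * (1 - cdf G.willingness p)

/-- Number of periods that a vehicle routed from `i` to `j` is occupied; a vehicle that is
"routed" from `i` to `i` idles for one period. -/
def duration (i j : Fin m) : ℕ := if i = j then 1 else G.tau i j

/-- The set of battery energy levels. -/
noncomputable def levels : Finset ℤ := Finset.Icc 0 (G.vmax : ℤ)

end Network

/-- Candidate solution of the static problem: prices, routing flows `x_ij^v` and charging
flows `x_ic^v`. -/
structure StaticSolution (m : ℕ) where
  price : Fin m → Fin m → ℝ
  x : Fin m → Fin m → ℤ → ℝ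
  xc : Fin m → ℤ → ℝ

namespace StaticSolution

variable {m : ℕ} (S : StaticSolution m) (G : Network m)

/-- Total flow `∑_k x_ik^v + x_ic^v` through node `i` at energy level `v`. -/
noncomputable def throughput (i : Fin m) (v : ℤ) : ℝ := ∑ k, S.x i k v + S.xc i v

/-- Total flow routed from `i` to `j`, `∑_{v = v_ij}^{vmax} x_ij^v`. -/
noncomputable def routedFlow (i j : Fin m) : ℝ :=
  ∑ v ∈ Finset.Icc (G.energyUse i j : ℤ) (G.vmax : ℤ), S.x i j v

/-- The constraints of the static profit maximization problem. -/
structure Feasible : Prop where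
  demand : ∀ i j, G.inducedRate i j (S.price i j) ≤ S.routedFlow G i j
  balance : ∀ i, ∀ v ∈ G.levels,
    S.xc i v + ∑ j, S.x i j v = S.xc i (v - 1) + ∑ j, S.x j i (v + G.energyUse j i)
  full : ∀ i, S.xc i G.vmax = 0
  enough : ∀ i j, ∀ v : ℤ, v < G.energyUse i j → S.x i j v = 0
  charge_nonneg : ∀ i, ∀ v ∈ G.levels, 0 ≤ S.xc i v
  route_nonneg : ∀ i j, ∀ v ∈ G.levels, 0 ≤ S.x i j v
  charge_zero : ∀ i, ∀ v, v ∉ G.levels → S.xc i v = 0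
  route_zero : ∀ i j, ∀ v, v ∉ G.levels → S.x i j v = 0

/-- A finite set of (node, energy level) pairs that no flow of the static solution leaves. -/
def IsClosed (C : Finset (Fin m × ℤ)) : Prop :=
  ∀ p ∈ C, (0 < S.xc p.1 p.2 → (p.1, p.2 + 1) ∈ C) ∧
    ∀ j, 0 < S.x p.1 j p.2 → (j, p.2 - G.energyUse p.1 j) ∈ C

/-- Number of vehicles that the static flow keeps occupied in `C`: the flows that start in `C`,
each multiplied by the number of periods for which it occupies a vehicle. -/
noncomputable def fleetSize (C : Finset (Fin m × ℤ)) : ℝ :=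
  ∑ p ∈ C, (S.xc p.1 p.2 + ∑ j, (G.duration p.1 j : ℝ) * S.x p.1 j p.2)

end StaticSolution

/-! ### The dynamic system -/

/-- What a vehicle at a node can be told to do; `route i` at node `i` means to stay idle. -/
inductive Decision (m : ℕ) where
  | route (j : Fin m)
  | charge
  deriving DecidableEq, Fintype

instance (m : ℕ) : MeasurableSpace (Decision m) := ⊤

instance (m : ℕ) : DiscreteMeasurableSpace (Decision m) := ⟨fun _ => trivial⟩

/-- Vehicle state. With `remaining = 0` the vehicle is at `node` with energy level `energy`,
available for a decision. Otherwise it is on its way and reaches `node` after `remaining`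
periods; the energy for the trip has already been deducted. -/
structure Vehicle (m : ℕ) where
  node : Fin m
  energy : ℤ
  remaining : ℕ

/-- State of the system with a fleet of `N` vehicles. -/
structure SysState (m N : ℕ) where
  queue : Fin m → Fin m → ℕ
  veh : Fin N → Vehicle m

/-- The random outcome of one period: one decision for each vehicle (without effect if the
vehicle is on its way), and the number of new ride requests for each pair. -/
abbrev Outcome (m N : ℕ) : Type := (Fin N → Decision m) × (Fin m → Fin m → ℕ)

/-- An action: the prices, and for each node `i` and energy level `v` the probability vector by
which each vehicle there is, independently, routed or charged. Vehicles with full battery do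
not charge, and trips for which the energy does not suffice are not started. -/
structure FleetAction {m : ℕ} (G : Network m) where
  price : Fin m → Fin m → ℝ
  decide : Fin m → ℤ → PMF (Decision m)
  full : ∀ i, decide i G.vmax Decision.charge = 0
  enough : ∀ i j, ∀ v ∈ G.levels, v < G.energyUse i j → decide i v (Decision.route j) = 0

/-- A policy chooses an action from the time and the current state. -/
abbrev Policy {m : ℕ} (G : Network m) (N : ℕ) : Type := ℕ → SysState m N → FleetAction G

/-- The policy that takes the same action at all times, in all states. -/
def Policy.static {m : ℕ} {G : Network m} (N : ℕ) (a : FleetAction G) : Policy G N := fun _ _ => a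

section Dynamics

variable {m : ℕ} (G : Network m) {N : ℕ}

/-- Evolution of a vehicle during one period. -/
def Vehicle.next (s : Vehicle m) (d : Decision m) : Vehicle m :=
  if s.remaining = 0 then
    match d with
    | Decision.charge => ⟨s.node, s.energy + 1, 0⟩
    | Decision.route j => ⟨j, s.energy - G.energyUse s.node j, G.duration s.node j - 1⟩
  else ⟨s.node, s.energy, s.remaining - 1⟩

/-- Number of vehicles with energy level `v` that are routed from `i` to `j` in a period. -/
def routedAt (s : SysState m N) (o : Outcome m N) (i j : Fin m) (v : ℤ) : ℕ :=
  (Finset.univ.filter fun n : Fin N =>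
    (s.veh n).remaining = 0 ∧ (s.veh n).node = i ∧ (s.veh n).energy = v ∧
      o.1 n = Decision.route j).card

/-- Number of vehicles routed from `i` to `j` in a period. -/
noncomputable def routed (s : SysState m N) (o : Outcome m N) (i j : Fin m) : ℕ :=
  ∑ v ∈ Finset.Icc (G.energyUse i j : ℤ) (G.vmax : ℤ), routedAt s o i j v

/-- One period: each routed vehicle serves one customer of its pair, if there is one (the
subtraction is truncated at zero). -/
noncomputable def SysState.next (s : SysState m N) (o : Outcome m N) : SysState m N where
  queue i j := s.queue i j + o.2 i j - routed G s o i j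
  veh n := (s.veh n).next G (o.1 n)

/-- State at time `t`, from the initial state and the outcomes of the periods before `t`. -/
noncomputable def stateAt (s₀ : SysState m N) (o : ℕ → Outcome m N) : ℕ → SysState m N
  | 0 => s₀
  | t + 1 => (stateAt s₀ o t).next G (o t)

/-- Law of the outcome of a period under an action: all vehicles draw their decisions
independently, and the numbers of ride requests are independent Poisson variables. -/
noncomputable def outcomeLaw (a : FleetAction G) (s : SysState m N) : Measure (Outcome m N) :=
  (Measure.pi fun n => (a.decide (s.veh n).node (s.veh n).energy).toMeasure).prod
    (Measure.pi fun i => Measure.pi fun j =>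
      poissonMeasure (G.inducedRate i j (a.price i j)).toNNReal)

instance (a : FleetAction G) (s : SysState m N) : IsProbabilityMeasure (outcomeLaw G a s) := by
  unfold outcomeLaw
  infer_instance

variable {G}

/-- Law of the outcome of period `t + 1`, given the outcomes of the periods `0, …, t`. -/
noncomputable def Policy.kernel (P : Policy G N) (s₀ : SysState m N) (t : ℕ) :
    Kernel (Finset.Iic t → Outcome m N) (Outcome m N) :=
  Kernel.ofFunOfCountable fun h =>
    let s := stateAt G s₀ (fun k => h ⟨min k t, Finset.mem_Iic.2 (min_le_right k t)⟩) (t + 1)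
    outcomeLaw G (P (t + 1) s) s

instance (P : Policy G N) (s₀ : SysState m N) (t : ℕ) : IsMarkovKernel (P.kernel s₀ t) :=
  ⟨fun h => by
    change IsProbabilityMeasure (outcomeLaw G _ _)
    infer_instance⟩

/-- Law of the sequence of outcomes of all periods, for the system started in `s₀` and operated
under the policy `P`. -/
noncomputable def Policy.law (P : Policy G N) (s₀ : SysState m N) :
    Measure (ℕ → Outcome m N) :=
  Kernel.trajMeasure (X := fun _ => Outcome m N) (outcomeLaw G (P 0 s₀) s₀) (P.kernel s₀)

/-- Rate stability: almost surely `q_ij(t) / t → 0` for all pairs. -/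
def RateStable (P : Policy G N) (s₀ : SysState m N) : Prop :=
  ∀ i j, ∀ᵐ o ∂P.law s₀,
    Tendsto (fun t : ℕ => ((stateAt G s₀ o t).queue i j : ℝ) / t) atTop (𝓝 0)

/-- The two time-average criteria, relative to a static solution: almost surely, for all pairs,
the number of ride requests per period averages to `λ_ij (1 - F(ℓ_ij))` and the number of
routed vehicles per period averages to `∑_{v = v_ij}^{vmax} x_ij^v`. -/
def MeetsCriteria (S : StaticSolution m) (P : Policy G N) (s₀ : SysState m N) : Prop :=
  ∀ i j, ∀ᵐ o ∂P.law s₀,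
    Tendsto (fun T : ℕ => (∑ t ∈ Finset.range T, ((o t).2 i j : ℝ)) / T) atTop
      (𝓝 (G.inducedRate i j (S.price i j))) ∧
    Tendsto (fun T : ℕ =>
        (∑ t ∈ Finset.range T, (routed G (stateAt G s₀ o t) (o t) i j : ℝ)) / T) atTop
      (𝓝 (S.routedFlow G i j))

end Dynamics

/-! ### The randomized policy and the fleet -/

/-- The action uses the prices of the static solution, and routes and charges with
probabilities proportional to the flows. Where the static solution has no flow at all, these
probabilities are undefined, and nothing is demanded. -/
def FleetAction.RandomizesBy {m : ℕ} {G : Network m} (a : FleetAction G) (S : StaticSolution m) : Prop :=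
  (∀ i j, a.price i j = S.price i j) ∧
  ∀ i, ∀ v ∈ G.levels, S.throughput i v ≠ 0 →
    (∀ j, (a.decide i v (Decision.route j)).toReal = S.x i j v / S.throughput i v) ∧
    (a.decide i v Decision.charge).toReal = S.xc i v / S.throughput i v

namespace SysState

variable {m N : ℕ} (s : SysState m N)

/-- All batteries have an admissible energy level. -/
def Valid (G : Network m) : Prop := ∀ n, (s.veh n).energy ∈ G.levels

/-- Number of vehicles whose node and energy level, present or upon arrival, lie in `C`. -/
def count (C : Finset (Fin m × ℤ)) : ℕ :=
  (Finset.univ.filter fun n : Fin N => ((s.veh n).node, (s.veh n).energy) ∈ C).card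

/-- In each part of the system that the static flow does not leave there are exactly as many
vehicles as the static flow keeps occupied there. -/
def FleetMatches (G : Network m) (S : StaticSolution m) : Prop :=
  ∀ C, S.IsClosed G C → (s.count C : ℝ) = S.fleetSize G C

/-- In each part of the system that the static flow does not leave there are at least as many
vehicles as the static flow keeps occupied there. -/
def FleetCovers (G : Network m) (S : StaticSolution m) : Prop :=
  ∀ C, S.IsClosed G C → S.fleetSize G C ≤ (s.count C : ℝ)

end SysState

/-!
Under the static randomized policy the vehicles are independent Markov chains on the pairs of a node
and an energy level, and the balance constraints of the static problem say that the throughput `y`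
of the static solution is an invariant measure of this chain. A pair is called active if its
throughput is positive. What has to be shown is that the active vehicles visit the active
pairs with long-run frequencies `w` such that `w = y` (matching fleet) or `w ≥ y` (covering fleet).

Regeneration cycles and the decomposition into communicating classes are avoided as follows.

* A strong law of large numbers along the trajectory (`ae_tendsto_average_sub_mean`, from
  orthogonality of martingale differences and interpolation between squares) shows that almost
  surely the decisions have the prescribed long-run frequencies at each pair. By two conservation
  laws, for the position and for the remaining travel time of a vehicle, the empirical occupation
  frequencies are then asymptotically invariant, and their weight on every closed set, measured in
  time, converges: to one if the vehicle starts there, to zero otherwise, as the complement of a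
  closed set is closed too (`IsClosedFor.compl`).
* A signed invariant vector with nonnegative weight on every closed set is nonnegative
  (`nonneg_of_invariant`), because the set where it is negative is closed. Hence the balance
  defects and the weights of closed sets determine a vector, linearly, so that the occupation
  frequencies converge to some invariant `w` (`exists_tendsto_of_asymptotically_invariant`). The
  weight of a closed set `C` under `w` is the number of vehicles that start in `C`, and its weight
  under `y` is the fleet size of `C`. The same lemma, applied to `w - y` and to `y - w`, compares
  the two.

For stability, the services by the active vehicles have a rate that exists as a limit and is at
least the arrival rate, and such a queue is rate stable (`tendsto_queue_div_zero`). A mere lower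
bound on the averages of the services would not suffice; this is why the vehicles that start at
inactive pairs are left out of account. In a matching fleet there are none.
-/

/-! ### The law of the trajectory and a strong law of large numbers -/

section Law

variable {m : ℕ} {G : Network m} {N : ℕ}

theorem stateAt_congr (s₀ : SysState m N) {o o' : ℕ → Outcome m N} {t : ℕ}
    (h : ∀ k < t, o k = o' k) : stateAt G s₀ o t = stateAt G s₀ o' t := by
  induction t with
  | zero => rfl
  | succ t ih =>
    simp only [stateAt]
    rw [ih fun k hk => h k (by omega), h t (by omega)]

theorem map_eval_zero_law (P : Policy G N) (s₀ : SysState m N) :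
    (P.law s₀).map (fun o => o 0) = outcomeLaw G (P 0 s₀) s₀ := by
  have h := Kernel.traj_map_frestrictLe (X := fun _ => Outcome m N) (κ := P.kernel s₀) 0 0
  have hf : (fun o : ℕ → Outcome m N => o 0) =
      (fun z : Finset.Iic 0 → Outcome m N => z ⟨0, Finset.mem_Iic.2 le_rfl⟩) ∘
        Preorder.frestrictLe (π := fun _ => Outcome m N) 0 := rfl
  rw [hf, ← Measure.map_map (by fun_prop) (by fun_prop), Policy.law, Kernel.trajMeasure,
    Measure.map_comp _ _ (by fun_prop), h, Kernel.partialTraj_self, Measure.id_comp,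
    Measure.map_map (by fun_prop) (by fun_prop)]
  exact Measure.map_id

/-- The period-`t` outcome, conditionally on the outcomes of the previous periods, follows the
law prescribed by the policy in the current state. -/
theorem lintegral_law_step (P : Policy G N) (s₀ : SysState m N) (t : ℕ)
    (F : (ℕ → Outcome m N) → Outcome m N → ENNReal)
    (hF : ∀ o o', (∀ k < t, o k = o' k) → F o = F o') :
    ∫⁻ o, F o (o t) ∂P.law s₀ =
      ∫⁻ o, ∫⁻ x, F o x ∂outcomeLaw G (P t (stateAt G s₀ o t)) (stateAt G s₀ o t) ∂P.law s₀ := by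
  cases t with
  | zero =>
    rcases isEmpty_or_nonempty (ℕ → Outcome m N) with he | ⟨⟨o₀⟩⟩
    · simp [lintegral_of_isEmpty]
    have h1 : ∀ o, F o = F o₀ := fun o => hF _ _ (by simp)
    have : IsProbabilityMeasure (P.law s₀) := by unfold Policy.law; infer_instance
    simp only [h1, stateAt, lintegral_const, measure_univ, mul_one]
    rw [← map_eval_zero_law P s₀, lintegral_map .of_discrete (by fun_prop)]
  | succ s =>
    -- extension of a finite history to a sequence, as in the definition of the policy's kernel
    let e : (Finset.Iic s → Outcome m N) → ℕ → Outcome m N :=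
      fun h k => h ⟨min k s, Finset.mem_Iic.2 (min_le_right k s)⟩
    have he : ∀ o : ℕ → Outcome m N, ∀ k < s + 1,
        o k = e (Preorder.frestrictLe (π := fun _ => Outcome m N) s o) k := by
      intro o k hk
      simp only [e, Preorder.frestrictLe_apply]
      congr 1
      omega
    have hmap := Kernel.map_frestrictLe_trajMeasure_compProd_eq_map_trajMeasure
      (X := fun _ => Outcome m N) (μ₀ := outcomeLaw G (P 0 s₀) s₀) (κ := P.kernel s₀) (a := s)
    change (P.law s₀).map _ ⊗ₘ _ = (P.law s₀).map _ at hmap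
    have hdisc : DiscreteMeasurableSpace ((Finset.Iic s → Outcome m N) × Outcome m N) :=
      MeasurableSingletonClass.toDiscreteMeasurableSpace
    calc ∫⁻ o, F o (o (s + 1)) ∂P.law s₀
        = ∫⁻ o, (fun z : (Finset.Iic s → Outcome m N) × Outcome m N => F (e z.1) z.2)
            (Preorder.frestrictLe (π := fun _ => Outcome m N) s o, o (s + 1)) ∂P.law s₀ := by
          refine lintegral_congr fun o => ?_
          simp only
          rw [hF _ _ (he o)]
      _ = ∫⁻ z, F (e z.1) z.2 ∂((P.law s₀).map
            (fun o => (Preorder.frestrictLe (π := fun _ => Outcome m N) s o, o (s + 1)))) := by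
          rw [lintegral_map .of_discrete (by fun_prop)]
      _ = _ := by
          have : IsProbabilityMeasure (P.law s₀) := by unfold Policy.law; infer_instance
          rw [← hmap, Measure.lintegral_compProd .of_discrete,
            lintegral_map .of_discrete (by fun_prop)]
          refine lintegral_congr fun o => ?_
          have h1 : stateAt G s₀ o (s + 1) = stateAt G s₀
            (e (Preorder.frestrictLe (π := fun _ => Outcome m N) s o)) (s + 1) :=
            stateAt_congr s₀ (he o)
          rw [h1, hF _ _ (he o)]
          rfl

instance (P : Policy G N) (s₀ : SysState m N) : IsProbabilityMeasure (P.law s₀) := by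
  unfold Policy.law
  infer_instance

/-- A function of finitely many outcomes is measurable, since the outcome space is countable and
discrete. -/
theorem measurable_of_past {β : Type*} [MeasurableSpace β] (t : ℕ) {f : (ℕ → Outcome m N) → β}
    (hf : ∀ o o', (∀ k < t, o k = o' k) → f o = f o') : Measurable f := by
  let e : (Finset.Iic t → Outcome m N) → ℕ → Outcome m N :=
    fun h k => h ⟨min k t, Finset.mem_Iic.2 (min_le_right k t)⟩
  have he : f = (fun z => f (e z)) ∘ Preorder.frestrictLe (π := fun _ => Outcome m N) t := by
    funext o
    refine hf _ _ fun k hk => ?_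
    simp only [e, Preorder.frestrictLe_apply]
    congr 1
    omega
  rw [he]
  exact Measurable.of_discrete.comp (by fun_prop)

/-- An event that has probability zero in every state happens in no period. -/
theorem ae_forall_of_outcomeLaw (a : FleetAction G) (s₀ : SysState m N)
    (p : SysState m N → Outcome m N → Prop) (hp : ∀ s, ∀ᵐ x ∂outcomeLaw G a s, p s x) :
    ∀ᵐ o ∂(Policy.static N a).law s₀, ∀ t, p (stateAt G s₀ o t) (o t) := by
  classical
  rw [ae_all_iff]
  intro t
  have hcongr : ∀ o o' : ℕ → Outcome m N, (∀ k < t, o k = o' k) →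
      stateAt G s₀ o t = stateAt G s₀ o' t := fun o o' h => stateAt_congr s₀ h
  have h := lintegral_law_step (Policy.static N a) s₀ t
    (fun o x => if p (stateAt G s₀ o t) x then 0 else 1)
    (fun o o' h => by simp only [hcongr o o' h])
  have h0 : ∀ s, ∫⁻ x, (if p s x then 0 else 1 : ENNReal) ∂outcomeLaw G a s = 0 := fun s => by
    rw [lintegral_eq_zero_iff .of_discrete]
    filter_upwards [hp s] with x hx
    simp [hx]
  simp only [Policy.static, h0, lintegral_zero] at h
  rw [lintegral_eq_zero_iff] at h
  · filter_upwards [h] with o ho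
    by_contra hc
    simp [hc] at ho
  · refine measurable_of_past (t + 1) fun o o' h => ?_
    rw [hcongr o o' fun k hk => h k (by omega), h t (by omega)]

/-- Orthogonality of martingale differences: the second moment of the sum grows linearly. -/
theorem lintegral_sq_sum_le (a : FleetAction G) (s₀ : SysState m N)
    (d : SysState m N → Outcome m N → ℝ) (c : ℝ) (hc : 0 ≤ c)
    (hL2 : ∀ s, MemLp (d s) 2 (outcomeLaw G a s)) (hmean : ∀ s, ∫ x, d s x ∂outcomeLaw G a s = 0)
    (hvar : ∀ s, ∫ x, d s x ^ 2 ∂outcomeLaw G a s ≤ c) (T : ℕ) :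
    ∫⁻ o, ENNReal.ofReal ((∑ t ∈ Finset.range T, d (stateAt G s₀ o t) (o t)) ^ 2)
      ∂(Policy.static N a).law s₀ ≤ ENNReal.ofReal (T * c) := by
  induction T with
  | zero => simp
  | succ T ih =>
    have hcongr : ∀ o o' : ℕ → Outcome m N, (∀ k < T, o k = o' k) → ∀ t ≤ T,
        stateAt G s₀ o t = stateAt G s₀ o' t :=
      fun o o' h t ht => stateAt_congr s₀ fun k hk => h k (by omega)
    have h := lintegral_law_step (Policy.static N a) s₀ T
      (fun o x => ENNReal.ofReal ((∑ t ∈ Finset.range T, d (stateAt G s₀ o t) (o t) +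
        d (stateAt G s₀ o T) x) ^ 2)) (fun o o' h => by
          have : ∑ t ∈ Finset.range T, d (stateAt G s₀ o t) (o t) =
              ∑ t ∈ Finset.range T, d (stateAt G s₀ o' t) (o' t) := by
            refine Finset.sum_congr rfl fun t ht => ?_
            rw [Finset.mem_range] at ht
            rw [hcongr o o' h t ht.le, h t ht]
          funext x
          rw [this, hcongr o o' h T le_rfl])
    simp only [Finset.sum_range_succ]
    rw [h]
    have hinner : ∀ (M : ℝ) (s : SysState m N),
        ∫⁻ x, ENNReal.ofReal ((M + d s x) ^ 2) ∂outcomeLaw G a s ≤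
          ENNReal.ofReal (M ^ 2) + ENNReal.ofReal c := by
      intro M s
      have hi : Integrable (fun x => (M + d s x) ^ 2) (outcomeLaw G a s) :=
        ((memLp_const M).add (hL2 s)).integrable_sq
      have hi1 : Integrable (d s) (outcomeLaw G a s) := (hL2 s).integrable (by norm_num)
      have hi2 := (hL2 s).integrable_sq
      rw [← ofReal_integral_eq_lintegral_ofReal hi (ae_of_all _ fun x => sq_nonneg _),
        ← ENNReal.ofReal_add (sq_nonneg M) hc]
      refine ENNReal.ofReal_le_ofReal ?_
      have : ∀ x, (M + d s x) ^ 2 = M ^ 2 + 2 * M * d s x + d s x ^ 2 := fun x => by ring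
      have e1 : ∫ x, (M ^ 2 + 2 * M * d s x + d s x ^ 2) ∂outcomeLaw G a s =
          ∫ x, (M ^ 2 + 2 * M * d s x) ∂outcomeLaw G a s + ∫ x, d s x ^ 2 ∂outcomeLaw G a s :=
        integral_add ((integrable_const _).add (hi1.const_mul _)) hi2
      have e2 : ∫ x, (M ^ 2 + 2 * M * d s x) ∂outcomeLaw G a s =
          ∫ _, M ^ 2 ∂outcomeLaw G a s + ∫ x, 2 * M * d s x ∂outcomeLaw G a s :=
        integral_add (integrable_const _) (hi1.const_mul _)
      simp only [this]
      rw [e1, e2, integral_const_mul, hmean s]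
      simpa using hvar s
    refine (lintegral_mono fun o => hinner _ _).trans ?_
    rw [lintegral_add_right _ measurable_const, lintegral_const, measure_univ, mul_one]
    refine (add_le_add_left ih _).trans (le_of_eq ?_)
    rw [← ENNReal.ofReal_add (by positivity) hc]
    congr 1
    push_cast
    ring

/-- Along the squares, the second moments of the averages are summable. -/
theorem ae_tendsto_sum_div_sq (a : FleetAction G) (s₀ : SysState m N)
    (d : SysState m N → Outcome m N → ℝ) (c : ℝ) (hc : 0 ≤ c)
    (hL2 : ∀ s, MemLp (d s) 2 (outcomeLaw G a s)) (hmean : ∀ s, ∫ x, d s x ∂outcomeLaw G a s = 0)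
    (hvar : ∀ s, ∫ x, d s x ^ 2 ∂outcomeLaw G a s ≤ c) :
    ∀ᵐ o ∂(Policy.static N a).law s₀, Tendsto (fun n : ℕ =>
      (∑ t ∈ Finset.range (n ^ 2), d (stateAt G s₀ o t) (o t)) / (n : ℝ) ^ 2) atTop (𝓝 0) := by
  set M : ℕ → (ℕ → Outcome m N) → ℝ :=
    fun T o => ∑ t ∈ Finset.range T, d (stateAt G s₀ o t) (o t) with hM
  have hmeas : ∀ T, Measurable (M T) := fun T => measurable_of_past T fun o o' h => by
    refine Finset.sum_congr rfl fun t ht => ?_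
    rw [Finset.mem_range] at ht
    rw [stateAt_congr (o' := o') s₀ fun k hk => h k (by omega), h t ht]
  have hbound : ∀ n : ℕ, ∫⁻ o, ENNReal.ofReal ((M (n ^ 2) o / (n : ℝ) ^ 2) ^ 2)
      ∂(Policy.static N a).law s₀ ≤ ENNReal.ofReal (c * (1 / (n : ℝ) ^ 2)) := by
    intro n
    have h := lintegral_sq_sum_le a s₀ d c hc hL2 hmean hvar (n ^ 2)
    have h1 : ∀ o, ENNReal.ofReal ((M (n ^ 2) o / (n : ℝ) ^ 2) ^ 2) =
        ENNReal.ofReal ((M (n ^ 2) o) ^ 2) * ENNReal.ofReal (1 / ((n : ℝ) ^ 2) ^ 2) := fun o => by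
      rw [← ENNReal.ofReal_mul (sq_nonneg _), div_pow, mul_one_div]
    simp only [h1]
    rw [lintegral_mul_const' _ _ ENNReal.ofReal_ne_top]
    refine (mul_le_mul_left h _).trans ?_
    rw [← ENNReal.ofReal_mul (by positivity)]
    refine ENNReal.ofReal_le_ofReal (le_of_eq ?_)
    rcases Nat.eq_zero_or_pos n with rfl | hn
    · simp
    · have : (n : ℝ) ≠ 0 := by positivity
      push_cast
      field_simp
  have hsum : ∫⁻ o, ∑' n : ℕ, ENNReal.ofReal ((M (n ^ 2) o / (n : ℝ) ^ 2) ^ 2)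
      ∂(Policy.static N a).law s₀ ≠ ⊤ := by
    rw [lintegral_tsum fun n =>
      (((hmeas _).div_const _).pow_const 2).ennreal_ofReal.aemeasurable]
    refine ne_top_of_le_ne_top ?_ (ENNReal.tsum_le_tsum hbound)
    exact Summable.tsum_ofReal_ne_top ((Real.summable_one_div_nat_pow.2 one_lt_two).mul_left c)
  have hfin := ae_lt_top' (AEMeasurable.tsum fun n =>
      (((hmeas _).div_const _).pow_const 2).ennreal_ofReal.aemeasurable) hsum
  filter_upwards [hfin] with o ho
  have h0 := ENNReal.tendsto_atTop_zero_of_tsum_ne_top ho.ne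
  have h1 := (ENNReal.continuousAt_toReal ENNReal.zero_ne_top).tendsto.comp h0
  have h2 := (Real.continuous_sqrt.tendsto _).comp h1
  simp only [ENNReal.toReal_zero, Real.sqrt_zero] at h2
  rw [tendsto_zero_iff_abs_tendsto_zero]
  refine h2.congr fun n => ?_
  simp [ENNReal.toReal_ofReal, sq_nonneg, Real.sqrt_sq_eq_abs, hM]

end Law

/-- Interpolation between squares. With nonnegative `g` and `0 ≤ h ≤ K`, the sum of `g - h` falls by
at most `K` per step, which is enough to bound it by its values at the two neighbouring squares. -/
theorem tendsto_average_of_tendsto_average_sq {g h : ℕ → ℝ} {K : ℝ} (hg : ∀ t, 0 ≤ g t)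
    (hh : ∀ t, 0 ≤ h t) (hK : ∀ t, h t ≤ K)
    (hlim : Tendsto (fun n : ℕ => (∑ t ∈ Finset.range (n ^ 2), (g t - h t)) / (n : ℝ) ^ 2)
      atTop (𝓝 0)) :
    Tendsto (fun T : ℕ => (∑ t ∈ Finset.range T, (g t - h t)) / (T : ℝ)) atTop (𝓝 0) := by
  set M : ℕ → ℝ := fun T => ∑ t ∈ Finset.range T, (g t - h t) with hM
  have hK0 : 0 ≤ K := (hh 0).trans (hK 0)
  have hinc : ∀ a b : ℕ, a ≤ b → M b - M a ≥ -(K * (b - a)) := by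
    intro a b hab
    induction b, hab using Nat.le_induction with
    | base => simp
    | succ b _ ih =>
      have : M (b + 1) = M b + (g b - h b) := Finset.sum_range_succ _ _
      have := hg b
      have := hK b
      push_cast
      nlinarith
  have hsqrt : Tendsto Nat.sqrt atTop atTop :=
    tendsto_atTop_atTop.2 fun b => ⟨b ^ 2, fun T hT => Nat.le_sqrt'.2 hT⟩
  have hl1 : Tendsto (fun T : ℕ => |M (T.sqrt ^ 2) / ((T.sqrt : ℕ) : ℝ) ^ 2|) atTop (𝓝 0) := by
    have := hlim.comp hsqrt
    exact (tendsto_zero_iff_abs_tendsto_zero _).1 this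
  have hl2 : Tendsto (fun T : ℕ => |M ((T.sqrt + 1) ^ 2) / ((T.sqrt + 1 : ℕ) : ℝ) ^ 2|)
      atTop (𝓝 0) := by
    have := hlim.comp ((tendsto_add_atTop_nat 1).comp hsqrt)
    exact (tendsto_zero_iff_abs_tendsto_zero _).1 this
  have hl3 : Tendsto (fun T : ℕ => 3 * K / ((T.sqrt : ℕ) : ℝ)) atTop (𝓝 0) :=
    (tendsto_const_div_atTop_nhds_zero_nat (3 * K)).comp hsqrt
  have hl := (hl1.add (hl2.const_mul 4)).add hl3
  simp only [mul_zero, add_zero] at hl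
  refine squeeze_zero_norm' ?_ hl
  filter_upwards [eventually_ge_atTop 1] with T hT
  have hn1 : 1 ≤ T.sqrt := Nat.le_sqrt'.2 (by simpa using hT)
  have hlow : T.sqrt ^ 2 ≤ T := Nat.sqrt_le' T
  have hup : T ≤ (T.sqrt + 1) ^ 2 := (Nat.lt_succ_sqrt' T).le
  generalize T.sqrt = n at *
  have i1 := hinc _ _ hlow
  have i2 := hinc _ _ hup
  have hn : (1 : ℝ) ≤ n := by exact_mod_cast hn1
  have hTl : (n : ℝ) ^ 2 ≤ T := by exact_mod_cast hlow
  have hTu : (T : ℝ) ≤ ((n : ℝ) + 1) ^ 2 := by exact_mod_cast hup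
  have hT0 : (0 : ℝ) < T := by positivity
  push_cast at i1 i2
  have habs : |M T| ≤ |M (n ^ 2)| + |M ((n + 1) ^ 2)| + K * (2 * n + 1) := by
    have e1 : K * ((T : ℝ) - n ^ 2) ≤ K * (2 * n + 1) :=
      mul_le_mul_of_nonneg_left (by linarith) hK0
    have e2 : K * (((n : ℝ) + 1) ^ 2 - T) ≤ K * (2 * n + 1) :=
      mul_le_mul_of_nonneg_left (by linarith) hK0
    have := neg_abs_le (M (n ^ 2))
    have := le_abs_self (M ((n + 1) ^ 2))
    have := abs_nonneg (M (n ^ 2))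
    have := abs_nonneg (M ((n + 1) ^ 2))
    rw [abs_le]
    constructor <;> linarith
  rw [Real.norm_eq_abs, abs_div, abs_of_pos hT0, div_le_iff₀ hT0]
  refine habs.trans ?_
  rw [abs_div, abs_div, abs_of_pos (by positivity : (0 : ℝ) < (n : ℝ) ^ 2),
    abs_of_pos (by positivity : (0 : ℝ) < ((n + 1 : ℕ) : ℝ) ^ 2), add_mul, add_mul]
  have f1 : |M (n ^ 2)| ≤ |M (n ^ 2)| / (n : ℝ) ^ 2 * T := by
    rw [div_mul_eq_mul_div, le_div_iff₀ (by positivity)]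
    exact mul_le_mul_of_nonneg_left hTl (abs_nonneg _)
  have f2 : |M ((n + 1) ^ 2)| ≤ 4 * (|M ((n + 1) ^ 2)| / ((n + 1 : ℕ) : ℝ) ^ 2) * T := by
    rw [mul_assoc, div_mul_eq_mul_div, ← mul_div_assoc, le_div_iff₀ (by positivity)]
    have : (((n + 1 : ℕ) : ℝ)) ^ 2 ≤ 4 * T := by push_cast; nlinarith
    nlinarith [mul_le_mul_of_nonneg_left this (abs_nonneg (M ((n + 1) ^ 2)))]
  have f3 : K * (2 * n + 1) ≤ 3 * K / n * T := by
    rw [div_mul_eq_mul_div, le_div_iff₀ (by positivity)]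
    have : (2 * (n : ℝ) + 1) * n ≤ 3 * T := by nlinarith
    nlinarith [mul_le_mul_of_nonneg_left this hK0]
  linarith

section LawOfLargeNumbers

variable {m : ℕ} {G : Network m} {N : ℕ}

/-- Strong law of large numbers along the trajectory: a nonnegative functional of state and
outcome and its conditional mean have asymptotically the same time average. -/
theorem ae_tendsto_average_sub_mean (a : FleetAction G) (s₀ : SysState m N)
    (g : SysState m N → Outcome m N → ℝ) (h : SysState m N → ℝ) (c K : ℝ) (hc : 0 ≤ c)
    (hg : ∀ s x, 0 ≤ g s x) (hL2 : ∀ s, MemLp (g s) 2 (outcomeLaw G a s))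
    (hmean : ∀ s, ∫ x, g s x ∂outcomeLaw G a s = h s) (hK : ∀ s, h s ≤ K)
    (hvar : ∀ s, ∫ x, (g s x - h s) ^ 2 ∂outcomeLaw G a s ≤ c) :
    ∀ᵐ o ∂(Policy.static N a).law s₀, Tendsto (fun T : ℕ =>
      (∑ t ∈ Finset.range T, (g (stateAt G s₀ o t) (o t) - h (stateAt G s₀ o t))) / (T : ℝ))
      atTop (𝓝 0) := by
  filter_upwards [ae_tendsto_sum_div_sq a s₀ (fun s x => g s x - h s) c hc
    (fun s => (hL2 s).sub (memLp_const _)) (fun s => by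
      rw [integral_sub ((hL2 s).integrable (by norm_num)) (integrable_const _), hmean s]
      simp) hvar] with o ho
  exact tendsto_average_of_tendsto_average_sq (g := fun t => g (stateAt G s₀ o t) (o t))
    (h := fun t => h (stateAt G s₀ o t)) (K := K) (fun t => hg _ _)
    (fun t => by rw [← hmean]; exact integral_nonneg fun x => hg _ x)
    (fun t => hK _) ho

end LawOfLargeNumbers

/-! ### Arrivals, decisions and rate stability of queues -/

section Poisson

open scoped NNReal Nat

theorem hasSum_mul_poisson (r : ℝ≥0) :
    HasSum (fun n : ℕ => Real.exp (-r) * r ^ n / n ! * (n : ℝ)) r := by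
  rw [← hasSum_nat_add_iff' 1]
  have h := (hasSum_one_poissonMeasure r).mul_left (r : ℝ)
  simp only [mul_one] at h
  simp only [Finset.range_one, Finset.sum_singleton, Nat.cast_zero, mul_zero, sub_zero]
  refine h.congr_fun fun n => ?_
  rw [Nat.factorial_succ]
  have : (n ! : ℝ) ≠ 0 := by positivity
  have : ((n : ℝ) + 1) ≠ 0 := by positivity
  push_cast
  field_simp
  ring

theorem hasSum_sq_mul_poisson (r : ℝ≥0) :
    HasSum (fun n : ℕ => Real.exp (-r) * r ^ n / n ! * (n : ℝ) ^ 2) (r * (r + 1)) := by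
  rw [← hasSum_nat_add_iff' 1]
  have h := ((hasSum_mul_poisson r).add (hasSum_one_poissonMeasure r)).mul_left (r : ℝ)
  simp only [Finset.range_one, Finset.sum_singleton, Nat.cast_zero, mul_zero, sub_zero,
    ne_eq, OfNat.ofNat_ne_zero, not_false_eq_true, zero_pow]
  refine h.congr_fun fun n => ?_
  rw [Nat.factorial_succ]
  have : (n ! : ℝ) ≠ 0 := by positivity
  have : ((n : ℝ) + 1) ≠ 0 := by positivity
  push_cast
  field_simp
  ring

theorem integrable_sq_poissonMeasure (r : ℝ≥0) :
    Integrable (fun n : ℕ => (n : ℝ) ^ 2) (poissonMeasure r) := by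
  rw [integrable_poissonMeasure_iff]
  simpa using (hasSum_sq_mul_poisson r).summable

theorem memLp_two_poissonMeasure (r : ℝ≥0) :
    MemLp (fun n : ℕ => (n : ℝ)) 2 (poissonMeasure r) :=
  (memLp_two_iff_integrable_sq .of_discrete).2 (integrable_sq_poissonMeasure r)

theorem integral_id_poissonMeasure (r : ℝ≥0) :
    ∫ n : ℕ, (n : ℝ) ∂poissonMeasure r = r := by
  rw [integral_poissonMeasure]
  simpa using (hasSum_mul_poisson r).tsum_eq

end Poisson

section Outcomes

variable {m : ℕ} {G : Network m} {N : ℕ}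

theorem measurePreserving_request (a : FleetAction G) (s : SysState m N) (i j : Fin m) :
    MeasurePreserving (fun x : Outcome m N => x.2 i j) (outcomeLaw G a s)
      (poissonMeasure (G.inducedRate i j (a.price i j)).toNNReal) :=
  ((measurePreserving_eval (fun j => poissonMeasure (G.inducedRate i j (a.price i j)).toNNReal)
    j).comp (measurePreserving_eval (fun i => Measure.pi fun j =>
      poissonMeasure (G.inducedRate i j (a.price i j)).toNNReal) i)).comp
    measurePreserving_snd

theorem measurePreserving_decision (a : FleetAction G) (s : SysState m N) (n : Fin N) :
    MeasurePreserving (fun x : Outcome m N => x.1 n) (outcomeLaw G a s)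
      (a.decide (s.veh n).node (s.veh n).energy).toMeasure :=
  (measurePreserving_eval
    (fun n => (a.decide (s.veh n).node (s.veh n).energy).toMeasure) n).comp measurePreserving_fst

theorem Network.inducedRate_nonneg (G : Network m) (i j : Fin m) (p : ℝ) :
    0 ≤ G.inducedRate i j p :=
  mul_nonneg (G.lam_nonneg i j) (sub_nonneg.2 (cdf_le_one _ _))

theorem ae_tendsto_requests (a : FleetAction G) (s₀ : SysState m N) (i j : Fin m) :
    ∀ᵐ o ∂(Policy.static N a).law s₀, Tendsto (fun T : ℕ =>
      (∑ t ∈ Finset.range T, ((o t).2 i j : ℝ)) / (T : ℝ)) atTop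
      (𝓝 (G.inducedRate i j (a.price i j))) := by
  set r := G.inducedRate i j (a.price i j) with hr
  have hr0 : 0 ≤ r := G.inducedRate_nonneg i j _
  have hmp := measurePreserving_request (N := N) a (i := i) (j := j)
  have hL2 : ∀ s : SysState m N, MemLp (fun x : Outcome m N => (x.2 i j : ℝ)) 2
      (outcomeLaw G a s) := fun s =>
    (memLp_two_poissonMeasure r.toNNReal).comp_measurePreserving (hmp s)
  have hmean : ∀ s : SysState m N, ∫ x, (x.2 i j : ℝ) ∂outcomeLaw G a s = r := fun s => by
    have h := integral_id_poissonMeasure r.toNNReal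
    rw [← (hmp s).map_eq, integral_map (hmp s).measurable.aemeasurable .of_discrete,
      Real.coe_toNNReal _ hr0] at h
    exact h
  have hvar : ∀ s : SysState m N, ∫ x, ((x.2 i j : ℝ) - r) ^ 2 ∂outcomeLaw G a s =
      ∫ k : ℕ, ((k : ℝ) - r) ^ 2 ∂poissonMeasure r.toNNReal := fun s => by
    rw [← (hmp s).map_eq, integral_map (hmp s).measurable.aemeasurable .of_discrete]
  filter_upwards [ae_tendsto_average_sub_mean a s₀ (fun _ x => (x.2 i j : ℝ)) (fun _ => r)
    (∫ k : ℕ, ((k : ℝ) - r) ^ 2 ∂poissonMeasure r.toNNReal) r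
    (integral_nonneg fun _ => sq_nonneg _) (fun _ _ => Nat.cast_nonneg _) hL2 hmean
    (fun _ => le_rfl) (fun s => (hvar s).le)] with o ho
  have h := ho.add_const r
  rw [zero_add] at h
  refine h.congr' ?_
  filter_upwards [eventually_gt_atTop 0] with T hT
  have : (T : ℝ) ≠ 0 := by positivity
  rw [Finset.sum_sub_distrib, Finset.sum_const, Finset.card_range, nsmul_eq_mul]
  field_simp
  ring

open Classical in
/-- Indicator that vehicle `n` is available at node `p.1` with energy level `p.2`. -/
noncomputable def SysState.avail (s : SysState m N) (n : Fin N) (p : Fin m × ℤ) : ℝ :=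
  if (s.veh n).remaining = 0 ∧ ((s.veh n).node, (s.veh n).energy) = p then 1 else 0

open Classical in
/-- Indicator that vehicle `n`, available at `p`, follows the decision `d`. -/
noncomputable def SysState.take (s : SysState m N) (x : Outcome m N) (n : Fin N) (p : Fin m × ℤ)
    (d : Decision m) : ℝ :=
  s.avail n p * if x.1 n = d then 1 else 0

theorem ae_tendsto_decisions (a : FleetAction G) (s₀ : SysState m N) (n : Fin N) (p : Fin m × ℤ)
    (d : Decision m) :
    ∀ᵐ o ∂(Policy.static N a).law s₀, Tendsto (fun T : ℕ =>
      (∑ t ∈ Finset.range T, ((stateAt G s₀ o t).take (o t) n p d -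
        (stateAt G s₀ o t).avail n p * (a.decide p.1 p.2 d).toReal)) / (T : ℝ)) atTop (𝓝 0) := by
  classical
  have hle : ∀ q : PMF (Decision m), (q d).toReal ≤ 1 := fun q =>
    ENNReal.toReal_le_of_le_ofReal zero_le_one (by simpa using q.coe_le_one d)
  have hav : ∀ s : SysState m N, s.avail n p = 0 ∨ s.avail n p = 1 ∧
      (s.veh n).node = p.1 ∧ (s.veh n).energy = p.2 := fun s => by
    unfold SysState.avail
    split_ifs with h
    · right
      rw [← h.2]
      simp
    · simp
  have hav01 : ∀ s : SysState m N, 0 ≤ s.avail n p ∧ s.avail n p ≤ 1 := fun s => by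
    rcases hav s with h | ⟨h, -⟩ <;> simp [h]
  have hg01 : ∀ (s : SysState m N) x, 0 ≤ s.take x n p d ∧ s.take x n p d ≤ 1 := fun s x => by
    unfold SysState.take
    split_ifs <;> simp [hav01 s]
  have hh01 : ∀ s : SysState m N, 0 ≤ s.avail n p * (a.decide p.1 p.2 d).toReal ∧
      s.avail n p * (a.decide p.1 p.2 d).toReal ≤ 1 := fun s =>
    ⟨mul_nonneg (hav01 s).1 ENNReal.toReal_nonneg,
      mul_le_one₀ (hav01 s).2 ENNReal.toReal_nonneg (hle _)⟩
  refine ae_tendsto_average_sub_mean a s₀ (fun s x => s.take x n p d)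
    (fun s => s.avail n p * (a.decide p.1 p.2 d).toReal) 1 1 zero_le_one
    (fun s x => (hg01 s x).1) (fun s => ?_) (fun s => ?_) (fun s => (hh01 s).2) (fun s => ?_)
  · refine MemLp.of_bound .of_discrete 1 (ae_of_all _ fun x => ?_)
    rw [Real.norm_eq_abs, abs_of_nonneg (hg01 s x).1]
    exact (hg01 s x).2
  · unfold SysState.take
    rw [integral_const_mul]
    rcases hav s with h | ⟨h, h1, h2⟩
    · simp [h]
    · have hmp := measurePreserving_decision a s n
      rw [h1, h2] at hmp
      have : ∫ x, (if x.1 n = d then (1 : ℝ) else 0) ∂outcomeLaw G a s =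
          ∫ y, (if y = d then (1 : ℝ) else 0) ∂(a.decide p.1 p.2).toMeasure := by
        rw [← hmp.map_eq, integral_map hmp.measurable.aemeasurable .of_discrete]
      rw [this, PMF.integral_eq_sum]
      simp
  · refine (integral_mono_of_nonneg (ae_of_all _ fun x => sq_nonneg _)
      (integrable_const (1 : ℝ)) (ae_of_all _ fun x => ?_)).trans (by simp)
    have := hg01 s x
    have := hh01 s
    simp only
    rw [sq_le_one_iff_abs_le_one, abs_le]
    constructor <;> linarith

theorem ae_forall_decide_ne_zero (a : FleetAction G) (s₀ : SysState m N) :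
    ∀ᵐ o ∂(Policy.static N a).law s₀, ∀ t n,
      a.decide ((stateAt G s₀ o t).veh n).node ((stateAt G s₀ o t).veh n).energy ((o t).1 n)
        ≠ 0 := by
  refine ae_forall_of_outcomeLaw a s₀
    (fun s x => ∀ n, a.decide (s.veh n).node (s.veh n).energy (x.1 n) ≠ 0) fun s => ?_
  rw [ae_all_iff]
  intro n
  have hmp := measurePreserving_decision a s n
  refine hmp.quasiMeasurePreserving.ae
    (p := fun d => a.decide (s.veh n).node (s.veh n).energy d ≠ 0) ?_
  rw [ae_iff]
  rw [PMF.toMeasure_apply_eq_zero_iff _ (MeasurableSet.of_discrete)]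
  rw [Set.disjoint_left]
  intro d hd hd'
  exact hd' ((PMF.mem_support_iff _ _).1 hd)

end Outcomes

/-- A queue whose arrivals have rate `α` and whose potential services dominate a sequence of rate
`β ≥ α` is rate stable. The services need a limiting rate: a lower bound on their averages would
allow long stretches without service. -/
theorem tendsto_queue_div_zero {q A x x' : ℕ → ℕ} (hq : ∀ t, q (t + 1) = q t + A t - x t)
    (hx : ∀ t, x' t ≤ x t) {α β : ℝ} (hαβ : α ≤ β)
    (hA : Tendsto (fun T : ℕ => (∑ t ∈ Finset.range T, (A t : ℝ)) / T) atTop (𝓝 α))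
    (hX : Tendsto (fun T : ℕ => (∑ t ∈ Finset.range T, (x' t : ℝ)) / T) atTop (𝓝 β)) :
    Tendsto (fun t : ℕ => (q t : ℝ) / t) atTop (𝓝 0) := by
  set D : ℕ → ℝ := fun T => ∑ t ∈ Finset.range T, ((A t : ℝ) - x' t) with hD
  -- the queue is bounded by the reflection of the net input
  have hrefl : ∀ T, (q T : ℝ) ≤ q 0 + D T ∨ ∃ s ≤ T, (q T : ℝ) ≤ D T - D s := by
    intro T
    induction T with
    | zero => left; simp [hD]
    | succ T ih =>
      have hs : D (T + 1) = D T + ((A T : ℝ) - x' T) := Finset.sum_range_succ _ _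
      rcases le_or_gt (q T + A T) (x T) with h | h
      · right
        refine ⟨T + 1, le_rfl, ?_⟩
        rw [hq, Nat.sub_eq_zero_of_le h]
        simp
      · have h1 : (q (T + 1) : ℝ) = q T + A T - x T := by
          rw [hq, Nat.cast_sub h.le]
          push_cast
          ring
        have h2 : (x' T : ℝ) ≤ x T := by exact_mod_cast hx T
        rcases ih with ih | ⟨s, hsT, ih⟩
        · left; linarith
        · right
          exact ⟨s, by omega, by linarith⟩
  have hDlim : Tendsto (fun T : ℕ => D T / T) atTop (𝓝 (α - β)) := by
    refine (hA.sub hX).congr fun T => ?_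
    simp only [hD, Finset.sum_sub_distrib, sub_div]
  rw [Metric.tendsto_atTop]
  intro ε hε
  rw [Metric.tendsto_atTop] at hDlim
  obtain ⟨T₀, hT₀⟩ := hDlim (ε / 4) (by positivity)
  -- a lower bound for the net input at all times, with a constant for the initial segment
  obtain ⟨K, hK⟩ : ∃ K : ℝ, ∀ s ≤ T₀, |D s| ≤ K := by
    refine ⟨∑ s ∈ Finset.range (T₀ + 1), |D s|, fun s hs => ?_⟩
    exact Finset.single_le_sum (f := fun s => |D s|) (fun _ _ => abs_nonneg _)
      (Finset.mem_range.2 (by omega))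
  have hK0 : 0 ≤ K := (abs_nonneg _).trans (hK 0 (by omega))
  obtain ⟨T₁, hT₁⟩ := exists_nat_gt ((K + q 0) / (ε / 4))
  refine ⟨max (T₀ + 1) T₁, fun T hT => ?_⟩
  have hTT₀ : T₀ + 1 ≤ T := (le_max_left _ _).trans hT
  have hTT₁ : (T₁ : ℝ) ≤ T := by exact_mod_cast (le_max_right _ _).trans hT
  have hTpos : (0 : ℝ) < T := by exact_mod_cast (by omega : 0 < T)
  have hKT : K + q 0 < ε / 4 * T := by
    rw [div_lt_iff₀ (by positivity)] at hT₁
    nlinarith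
  have hbd : ∀ s : ℕ, T₀ < s → |D s - (α - β) * s| ≤ ε / 4 * s := fun s hs => by
    have hs0 : (0 : ℝ) < s := by exact_mod_cast (by omega : 0 < s)
    have h := (hT₀ s hs.le).le
    rw [Real.dist_eq] at h
    have e : D s - (α - β) * s = (D s / s - (α - β)) * s := by field_simp
    rw [e, abs_mul, abs_of_pos hs0]
    exact mul_le_mul_of_nonneg_right h hs0.le
  have hDT := abs_le.1 (hbd T (by omega))
  have hneg : (α - β) * (T : ℝ) ≤ 0 := mul_nonpos_of_nonpos_of_nonneg (by linarith) hTpos.le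
  have hq0 : (0 : ℝ) ≤ q 0 := Nat.cast_nonneg _
  rw [dist_zero_right, Real.norm_eq_abs, abs_of_nonneg (by positivity), div_lt_iff₀ hTpos]
  rcases hrefl T with h | ⟨s, hsT, h⟩
  · nlinarith
  · rcases le_or_gt s T₀ with hs | hs
    · have := neg_abs_le (D s)
      have := hK s hs
      nlinarith
    · have h2 := abs_le.1 (hbd s hs)
      have hsT' : (s : ℝ) ≤ T := by exact_mod_cast hsT
      nlinarith [mul_le_mul_of_nonneg_left hsT' (by linarith : 0 ≤ β - α),
        mul_le_mul_of_nonneg_left hsT' hε.le]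

/-! ### Asymptotically invariant vectors of a finite stochastic matrix -/

section Invariant

variable {ι : Type*} [Fintype ι]

/-- `C` is closed for the transition weights `Q`: no positive weight leads out of it. -/
def IsClosedFor (Q : ι → ι → ℝ) (C : Finset ι) : Prop :=
  ∀ p ∈ C, ∀ q, 0 < Q p q → q ∈ C

/-- The complement of a closed set is closed if there is a positive invariant measure: by
conservation nothing flows into a closed set. -/
theorem IsClosedFor.compl [DecidableEq ι] {Q : ι → ι → ℝ} (hQ : ∀ p q, 0 ≤ Q p q)
    (hrow : ∀ p, ∑ q, Q p q = 1) {y : ι → ℝ} (hy : ∀ p, 0 < y p)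
    (hinv : ∀ q, ∑ p, y p * Q p q = y q) {C : Finset ι} (hC : IsClosedFor Q C) :
    IsClosedFor Q Cᶜ := by
  intro p hp q hpq
  rw [Finset.mem_compl] at hp ⊢
  intro hq
  have h1 : ∑ r ∈ C, ∑ s, y s * Q s r = ∑ r ∈ C, y r := Finset.sum_congr rfl fun r _ => hinv r
  rw [Finset.sum_comm, ← Finset.sum_add_sum_compl C] at h1
  have h2 : ∑ s ∈ C, ∑ r ∈ C, y s * Q s r = ∑ s ∈ C, y s := by
    refine Finset.sum_congr rfl fun s hs => ?_
    rw [← Finset.mul_sum]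
    have : ∑ r ∈ C, Q s r = 1 := by
      rw [← hrow s]
      refine Finset.sum_subset (Finset.subset_univ _) fun r _ hr => ?_
      by_contra hne
      exact hr (hC s hs r (lt_of_le_of_ne (hQ s r) (Ne.symm hne)))
    rw [this, mul_one]
  rw [h2] at h1
  have h3 : 0 < ∑ s ∈ Cᶜ, ∑ r ∈ C, y s * Q s r := by
    have hnn : ∀ s r, 0 ≤ y s * Q s r := fun s r => mul_nonneg (hy s).le (hQ s r)
    refine Finset.sum_pos' (fun s _ => Finset.sum_nonneg fun r _ => hnn s r)
      ⟨p, Finset.mem_compl.2 hp, Finset.sum_pos' (fun r _ => hnn p r)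
        ⟨q, hq, mul_pos (hy p) hpq⟩⟩
  linarith

/-- An invariant signed vector that has nonnegative weight on all closed sets is nonnegative: its
negative part is subinvariant, hence invariant, so its support is closed. -/
theorem nonneg_of_invariant {Q : ι → ι → ℝ} (hQ : ∀ p q, 0 ≤ Q p q)
    (hrow : ∀ p, ∑ q, Q p q = 1) {D : ι → ℝ} (hD : ∀ p, 0 < D p) {w : ι → ℝ}
    (hinv : ∀ q, ∑ p, w p * Q p q = w q)
    (hw : ∀ C, IsClosedFor Q C → 0 ≤ ∑ p ∈ C, D p * w p) (p : ι) : 0 ≤ w p := by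
  classical
  set z : ι → ℝ := fun p => max (-w p) 0 with hz
  have hz0 : ∀ p, 0 ≤ z p := fun p => le_max_right _ _
  have hterm : ∀ p q, 0 ≤ z p * Q p q := fun p q => mul_nonneg (hz0 p) (hQ p q)
  -- `z`, the negative part of `w`, is subinvariant; its total mass is preserved, so equality holds
  have hsub : ∀ q, z q ≤ ∑ p, z p * Q p q := by
    intro q
    refine max_le ?_ (Finset.sum_nonneg fun p _ => hterm p q)
    rw [← hinv q, ← Finset.sum_neg_distrib]
    refine Finset.sum_le_sum fun p _ => ?_
    rw [← neg_mul]
    exact mul_le_mul_of_nonneg_right (le_max_left _ _) (hQ p q)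
  have htot : ∑ q, ∑ p, z p * Q p q = ∑ q, z q := by
    rw [Finset.sum_comm]
    refine Finset.sum_congr rfl fun p _ => ?_
    rw [← Finset.mul_sum, hrow, mul_one]
  have hzinv : ∀ q, z q = ∑ p, z p * Q p q := fun q =>
    (Finset.sum_eq_sum_iff_of_le fun q _ => hsub q).1 htot.symm q (Finset.mem_univ q)
  have hclosed : IsClosedFor Q (Finset.univ.filter fun p => w p < 0) := by
    intro p hp q hpq
    rw [Finset.mem_filter] at hp ⊢
    have hzp : 0 < z p := lt_max_of_lt_left (neg_pos.2 hp.2)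
    have hzq : 0 < z q := by
      rw [hzinv q]
      exact Finset.sum_pos' (fun r _ => hterm r q) ⟨p, Finset.mem_univ p, mul_pos hzp hpq⟩
    refine ⟨Finset.mem_univ q, ?_⟩
    rcases lt_max_iff.1 hzq with h | h
    · linarith
    · exact absurd h (lt_irrefl 0)
  by_contra hneg
  have hlt : ∑ p ∈ Finset.univ.filter (fun p => w p < 0), D p * w p < 0 := by
    refine Finset.sum_neg (fun r hr => ?_) ⟨p, ?_⟩
    · exact mul_neg_of_pos_of_neg (hD r) (Finset.mem_filter.1 hr).2
    · exact Finset.mem_filter.2 ⟨Finset.mem_univ p, not_le.1 hneg⟩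
  exact absurd (hw _ hclosed) (not_le.2 hlt)

/-- The balance defects and the weights of the closed sets determine a vector; so a sequence of
vectors converges as soon as its balance defects vanish asymptotically and its weights on closed
sets converge. -/
theorem exists_tendsto_of_asymptotically_invariant {Q : ι → ι → ℝ} (hQ : ∀ p q, 0 ≤ Q p q)
    (hrow : ∀ p, ∑ q, Q p q = 1) {D : ι → ℝ} (hD : ∀ p, 0 < D p) {u : ℕ → ι → ℝ}
    (hinv : ∀ q, Tendsto (fun T => u T q - ∑ p, u T p * Q p q) atTop (𝓝 0)) {c : Finset ι → ℝ}
    (hc : ∀ C, IsClosedFor Q C → Tendsto (fun T => ∑ p ∈ C, D p * u T p) atTop (𝓝 (c C))) :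
    ∃ w : ι → ℝ, Tendsto u atTop (𝓝 w) ∧ (∀ q, ∑ p, w p * Q p q = w q) ∧
      ∀ C, IsClosedFor Q C → ∑ p ∈ C, D p * w p = c C := by
  let Φ : (ι → ℝ) →ₗ[ℝ] (ι → ℝ) × ({C // IsClosedFor Q C} → ℝ) :=
    { toFun := fun w => (fun q => w q - ∑ p, w p * Q p q, fun C => ∑ p ∈ C.1, D p * w p)
      map_add' := fun w w' => by
        ext <;> simp [add_mul, mul_add, Finset.sum_add_distrib]
        ring
      map_smul' := fun r w => by
        ext
        · simp [mul_assoc, Finset.mul_sum, mul_sub]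
        · simp [Finset.mul_sum, mul_left_comm] }
  have hker : LinearMap.ker Φ = ⊥ := by
    rw [LinearMap.ker_eq_bot']
    intro w hw
    have h1 : ∀ q, ∑ p, w p * Q p q = w q := fun q => by
      have := congrFun (congrArg Prod.fst hw) q
      exact (sub_eq_zero.1 this).symm
    have h2 : ∀ C, IsClosedFor Q C → ∑ p ∈ C, D p * w p = 0 := fun C hC =>
      congrFun (congrArg Prod.snd hw) ⟨C, hC⟩
    funext p
    refine le_antisymm ?_ (nonneg_of_invariant hQ hrow hD h1 (fun C hC => (h2 C hC).ge) p)
    have := nonneg_of_invariant (w := fun p => -w p) hQ hrow hD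
      (fun q => by simp [Finset.sum_neg_distrib, h1 q])
      (fun C hC => by simp [Finset.sum_neg_distrib, h2 C hC]) p
    simpa using this
  obtain ⟨Ψ, hΨ⟩ := Φ.exists_leftInverse_of_injective hker
  have hΨΦ : ∀ w, Ψ (Φ w) = w := fun w => LinearMap.congr_fun hΨ w
  have hlim : Tendsto (fun T => Φ (u T)) atTop
      (𝓝 (0, fun C : {C // IsClosedFor Q C} => c C.1)) :=
    (tendsto_pi_nhds.2 hinv).prodMk_nhds (tendsto_pi_nhds.2 fun C => hc C.1 C.2)
  have hcΨ : Continuous Ψ := Ψ.continuous_of_finiteDimensional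
  have hcΦ : Continuous Φ := Φ.continuous_of_finiteDimensional
  have hu := (hcΨ.tendsto _).comp hlim
  have hu' : Tendsto u atTop (𝓝 (Ψ (0, fun C => c C.1))) := hu.congr fun T => hΨΦ (u T)
  set w := Ψ (0, fun C => c C.1) with hw
  have hΦw : Φ w = (0, fun C => c C.1) :=
    tendsto_nhds_unique ((hcΦ.tendsto w).comp hu') hlim
  refine ⟨w, hu', fun q => ?_, fun C hC => congrFun (congrArg Prod.snd hΦw) ⟨C, hC⟩⟩
  have := congrFun (congrArg Prod.fst hΦw) q
  exact (sub_eq_zero.1 this).symm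

end Invariant

/-! ### The static flow as an invariant measure -/

section Flows

variable {m : ℕ}

theorem Decision.sum_eq {β : Type*} [AddCommMonoid β] (f : Decision m → β) :
    ∑ d, f d = f Decision.charge + ∑ j, f (Decision.route j) := by
  let e : Option (Fin m) ≃ Decision m :=
    { toFun := fun o => o.elim Decision.charge Decision.route
      invFun := fun d => match d with
        | Decision.charge => none
        | Decision.route j => some j
      left_inv := fun o => by cases o <;> rfl
      right_inv := fun d => by cases d <;> rfl }
  rw [← e.sum_comp, Fintype.sum_option]
  rfl

/-- Node and energy level at which a vehicle becomes available again when it follows the decision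
at the node `p.1` with energy level `p.2`. -/
def Decision.target (G : Network m) (p : Fin m × ℤ) : Decision m → Fin m × ℤ
  | .charge => (p.1, p.2 + 1)
  | .route j => (j, p.2 - G.energyUse p.1 j)

/-- Number of periods that a decision occupies a vehicle. -/
def Decision.time (G : Network m) (p : Fin m × ℤ) : Decision m → ℕ
  | .charge => 1
  | .route j => G.duration p.1 j

theorem Decision.one_le_time (G : Network m) (p : Fin m × ℤ) (d : Decision m) :
    1 ≤ d.time G p := by
  cases d with
  | charge => exact le_rfl
  | route j =>
    simp only [Decision.time, Network.duration]
    split_ifs with h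
    · exact le_rfl
    · exact G.tau_pos _ _ h

/-- Static flow of vehicles that follow the decision at the node `p.1` with energy level `p.2`. -/
def StaticSolution.flow (S : StaticSolution m) (p : Fin m × ℤ) : Decision m → ℝ
  | .charge => S.xc p.1 p.2
  | .route j => S.x p.1 j p.2

/-- The pairs of a node and an energy level through which there is a static flow. -/
noncomputable def StaticSolution.active (S : StaticSolution m) (G : Network m) :
    Finset (Fin m × ℤ) :=
  (Finset.univ ×ˢ G.levels).filter fun p => 0 < S.throughput p.1 p.2

variable {G : Network m} {S : StaticSolution m}

theorem StaticSolution.mem_active {p : Fin m × ℤ} :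
    p ∈ S.active G ↔ p.2 ∈ G.levels ∧ 0 < S.throughput p.1 p.2 := by
  simp [StaticSolution.active]

theorem Network.mem_levels {v : ℤ} : v ∈ G.levels ↔ 0 ≤ v ∧ v ≤ G.vmax := by
  simp [Network.levels]

theorem StaticSolution.throughput_eq (S : StaticSolution m) (p : Fin m × ℤ) :
    S.throughput p.1 p.2 = ∑ d, S.flow p d := by
  rw [Decision.sum_eq, StaticSolution.throughput, add_comm]
  rfl

theorem StaticSolution.fleetSize_eq (C : Finset (Fin m × ℤ)) :
    S.fleetSize G C = ∑ p ∈ C, ∑ d : Decision m, (d.time G p : ℝ) * S.flow p d := by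
  refine Finset.sum_congr rfl fun p _ => ?_
  rw [Decision.sum_eq]
  simp [Decision.time, StaticSolution.flow]

theorem StaticSolution.isClosed_iff {C : Finset (Fin m × ℤ)} :
    S.IsClosed G C ↔ ∀ p ∈ C, ∀ d : Decision m, 0 < S.flow p d → d.target G p ∈ C := by
  refine forall₂_congr fun p _ => ⟨fun h d hd => ?_, fun h => ⟨h .charge, fun j => h (.route j)⟩⟩
  cases d with
  | charge => exact h.1 hd
  | route j => exact h.2 j hd

namespace StaticSolution.Feasible

variable (hS : S.Feasible G)
include hS

theorem flow_nonneg (p : Fin m × ℤ) (d : Decision m) : 0 ≤ S.flow p d := by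
  by_cases hp : p.2 ∈ G.levels
  · cases d with
    | charge => exact hS.charge_nonneg _ _ hp
    | route j => exact hS.route_nonneg _ _ _ hp
  · cases d with
    | charge => exact (hS.charge_zero _ _ hp).ge
    | route j => exact (hS.route_zero _ _ _ hp).ge

theorem throughput_nonneg (p : Fin m × ℤ) : 0 ≤ S.throughput p.1 p.2 := by
  rw [S.throughput_eq]
  exact Finset.sum_nonneg fun d _ => hS.flow_nonneg p d

theorem mem_active_of_flow_pos {p : Fin m × ℤ} {d : Decision m} (h : 0 < S.flow p d) :
    p ∈ S.active G := by
  rw [StaticSolution.mem_active]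
  refine ⟨?_, ?_⟩
  · by_contra hp
    cases d with
    | charge => exact h.ne' (hS.charge_zero _ _ hp)
    | route j => exact h.ne' (hS.route_zero _ _ _ hp)
  · rw [S.throughput_eq]
    exact h.trans_le (Finset.single_le_sum (fun d _ => hS.flow_nonneg p d) (Finset.mem_univ d))

theorem flow_eq_zero {p : Fin m × ℤ} (hp : p ∉ S.active G) (d : Decision m) : S.flow p d = 0 := by
  by_contra h
  exact hp (hS.mem_active_of_flow_pos (lt_of_le_of_ne (hS.flow_nonneg p d) (Ne.symm h)))

/-- The balance constraint: the flows that end at an energy level of a node add up to its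
throughput. -/
theorem sum_flow_target {q : Fin m × ℤ} (hq : q.2 ∈ G.levels) :
    ∑ p ∈ S.active G, ∑ d : Decision m, (if d.target G p = q then S.flow p d else 0) =
      S.throughput q.1 q.2 := by
  have h1 : ∑ p ∈ S.active G, ∑ d : Decision m, (if d.target G p = q then S.flow p d else 0) =
      ∑ p ∈ Finset.univ ×ˢ G.levels,
        ∑ d : Decision m, (if d.target G p = q then S.flow p d else 0) := by
    refine Finset.sum_subset (Finset.filter_subset _ _) fun p _ hp => ?_
    simp [hS.flow_eq_zero hp]
  have hb := hS.balance q.1 q.2 hq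
  rw [h1, Finset.sum_product, StaticSolution.throughput, add_comm, hb]
  have hcharge : ∀ (k : Fin m) (v : ℤ), (Decision.charge.target G (k, v) = q) ↔
      (k = q.1 ∧ v = q.2 - 1) := fun k v => by
    rw [Prod.ext_iff]
    simp only [Decision.target]
    exact and_congr_right fun _ => by constructor <;> intro h <;> linarith
  have hroute : ∀ (k : Fin m) (v : ℤ) (j : Fin m), ((Decision.route j).target G (k, v) = q) ↔
      (j = q.1 ∧ v = q.2 + G.energyUse k q.1) := fun k v j => by
    rw [Prod.ext_iff]
    simp only [Decision.target]
    refine and_congr_right fun h => ?_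
    subst h
    constructor <;> intro h <;> linarith
  simp only [Decision.sum_eq, Finset.sum_add_distrib, hcharge, hroute, ite_and,
    Finset.sum_ite_eq', Finset.mem_univ, if_true]
  congr 1
  · rw [Finset.sum_eq_single q.1 (fun k _ hk => Finset.sum_eq_zero fun v _ => if_neg hk)
      (fun h => absurd (Finset.mem_univ _) h)]
    simp only [if_true, Finset.sum_ite_eq']
    split_ifs with h
    · rfl
    · exact (hS.charge_zero _ _ h).symm
  · refine Finset.sum_congr rfl fun k _ => ?_
    split_ifs with h
    · rfl
    · exact (hS.route_zero _ _ _ h).symm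

theorem target_mem_levels {p : Fin m × ℤ} {d : Decision m} (h : 0 < S.flow p d) :
    (d.target G p).2 ∈ G.levels := by
  have hp := (StaticSolution.mem_active.1 (hS.mem_active_of_flow_pos h)).1
  rw [Network.mem_levels] at hp ⊢
  cases d with
  | charge =>
    have hne : p.2 ≠ G.vmax := fun he => by
      have h' : 0 < S.xc p.1 p.2 := h
      rw [he, hS.full] at h'
      exact lt_irrefl _ h'
    simp only [Decision.target]
    omega
  | route j =>
    have hge : (G.energyUse p.1 j : ℤ) ≤ p.2 := by
      by_contra hlt
      have h' : 0 < S.x p.1 j p.2 := h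
      rw [hS.enough _ _ _ (not_le.1 hlt)] at h'
      exact lt_irrefl _ h'
    simp only [Decision.target]
    omega

theorem target_mem_active {p : Fin m × ℤ} {d : Decision m} (h : 0 < S.flow p d) :
    d.target G p ∈ S.active G := by
  rw [StaticSolution.mem_active]
  refine ⟨hS.target_mem_levels h, ?_⟩
  rw [← hS.sum_flow_target (hS.target_mem_levels h)]
  have hnn : ∀ (r : Fin m × ℤ) (e : Decision m),
      0 ≤ (if e.target G r = d.target G p then S.flow r e else 0) := fun r e => by
    split_ifs
    exacts [hS.flow_nonneg r e, le_rfl]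
  refine Finset.sum_pos' (fun r _ => Finset.sum_nonneg fun e _ => hnn r e)
    ⟨p, hS.mem_active_of_flow_pos h, Finset.sum_pos' (fun e _ => hnn p e)
      ⟨d, Finset.mem_univ d, ?_⟩⟩
  rw [if_pos rfl]
  exact h

end StaticSolution.Feasible

/-- Transition weight between active pairs under the decision probabilities of an action. -/
noncomputable def FleetAction.transition (a : FleetAction G) (S : StaticSolution m)
    (p q : S.active G) : ℝ :=
  ∑ d : Decision m, if d.target G p.1 = q.1 then (a.decide p.1.1 p.1.2 d).toReal else 0

/-- Mean number of periods that a decision at `p` occupies a vehicle. -/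
noncomputable def FleetAction.meanTime (a : FleetAction G) (p : Fin m × ℤ) : ℝ :=
  ∑ d : Decision m, (d.time G p : ℝ) * (a.decide p.1 p.2 d).toReal

theorem PMF.sum_toReal_eq_one {α : Type*} [Fintype α] (q : PMF α) : ∑ x, (q x).toReal = 1 := by
  rw [← ENNReal.toReal_sum fun x _ => q.apply_ne_top x, ← tsum_fintype (L := .unconditional α),
    q.tsum_coe, ENNReal.toReal_one]

theorem FleetAction.meanTime_pos (a : FleetAction G) (p : Fin m × ℤ) : 0 < a.meanTime p := by
  have h : ∑ d, (a.decide p.1 p.2 d).toReal ≤ a.meanTime p := by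
    refine Finset.sum_le_sum fun d _ => le_mul_of_one_le_left ENNReal.toReal_nonneg ?_
    exact_mod_cast d.one_le_time G p
  rw [PMF.sum_toReal_eq_one] at h
  linarith

theorem FleetAction.transition_nonneg (a : FleetAction G) (p q : S.active G) :
    0 ≤ a.transition S p q :=
  Finset.sum_nonneg fun d _ => by split_ifs; exacts [ENNReal.toReal_nonneg, le_rfl]

namespace FleetAction.RandomizesBy

variable {a : FleetAction G} (ha : a.RandomizesBy S)
include ha

theorem decide_eq {p : Fin m × ℤ} (hp : p ∈ S.active G) (d : Decision m) :
    (a.decide p.1 p.2 d).toReal = S.flow p d / S.throughput p.1 p.2 := by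
  obtain ⟨h1, h2⟩ := StaticSolution.mem_active.1 hp
  have h := ha.2 p.1 p.2 h1 h2.ne'
  cases d with
  | charge => exact h.2
  | route j => exact h.1 j

theorem throughput_mul_decide {p : Fin m × ℤ} (hp : p ∈ S.active G) (d : Decision m) :
    S.throughput p.1 p.2 * (a.decide p.1 p.2 d).toReal = S.flow p d := by
  rw [ha.decide_eq hp, mul_div_cancel₀]
  exact (StaticSolution.mem_active.1 hp).2.ne'

theorem flow_pos {p : Fin m × ℤ} (hp : p ∈ S.active G) {d : Decision m}
    (hd : a.decide p.1 p.2 d ≠ 0) : 0 < S.flow p d := by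
  rw [← ha.throughput_mul_decide hp]
  exact mul_pos (StaticSolution.mem_active.1 hp).2
    (ENNReal.toReal_pos hd (PMF.apply_ne_top _ _))

theorem transition_row (hS : S.Feasible G) (p : S.active G) : ∑ q, a.transition S p q = 1 := by
  classical
  rw [← PMF.sum_toReal_eq_one (a.decide p.1.1 p.1.2)]
  simp only [FleetAction.transition]
  rw [Finset.sum_comm]
  refine Finset.sum_congr rfl fun d _ => ?_
  by_cases hd : a.decide p.1.1 p.1.2 d = 0
  · simp [hd]
  · have ht := hS.target_mem_active (ha.flow_pos p.2 hd)
    rw [Finset.sum_eq_single ⟨_, ht⟩ (fun q _ hq => if_neg fun h => hq (Subtype.ext h.symm))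
      (by simp)]
    exact if_pos rfl

theorem transition_invariant (hS : S.Feasible G) (q : S.active G) :
    ∑ p : S.active G, S.throughput p.1.1 p.1.2 * a.transition S p q =
      S.throughput q.1.1 q.1.2 := by
  rw [← hS.sum_flow_target (StaticSolution.mem_active.1 q.2).1,
    ← Finset.sum_coe_sort (S.active G)
      fun p => ∑ d : Decision m, if d.target G p = q.1 then S.flow p d else 0]
  refine Finset.sum_congr rfl fun p _ => ?_
  rw [FleetAction.transition, Finset.mul_sum]
  refine Finset.sum_congr rfl fun d _ => ?_
  rw [mul_ite, mul_zero, ha.throughput_mul_decide p.2]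

theorem isClosedFor_iff (hS : S.Feasible G) {C : Finset (S.active G)} :
    IsClosedFor (a.transition S) C ↔ S.IsClosed G (C.map (Function.Embedding.subtype _)) := by
  rw [StaticSolution.isClosed_iff]
  have hpos : ∀ (p q : S.active G), 0 < a.transition S p q ↔
      ∃ d : Decision m, 0 < S.flow p.1 d ∧ d.target G p.1 = q.1 := by
    intro p q
    constructor
    · intro h
      by_contra! hne
      refine h.ne' (Finset.sum_eq_zero fun d _ => ?_)
      split_ifs with hd
      · by_contra h0
        refine hne d (ha.flow_pos p.2 fun h1 => h0 (by rw [h1]; rfl)) hd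
      · rfl
    · rintro ⟨d, hd, hdq⟩
      refine Finset.sum_pos' (fun d _ => ?_) ⟨d, Finset.mem_univ d, ?_⟩
      · split_ifs
        exacts [ENNReal.toReal_nonneg, le_rfl]
      · rw [if_pos hdq, ha.decide_eq p.2]
        exact div_pos hd (StaticSolution.mem_active.1 p.2).2
  constructor
  · intro h p hp d hd
    obtain ⟨p, hpC, rfl⟩ := Finset.mem_map.1 hp
    exact Finset.mem_map.2 ⟨⟨_, hS.target_mem_active hd⟩, h p hpC _ ((hpos _ _).2 ⟨d, hd, rfl⟩), rfl⟩
  · intro h p hp q hq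
    obtain ⟨d, hd, hdq⟩ := (hpos p q).1 hq
    obtain ⟨q', hq', he⟩ := Finset.mem_map.1 (h p.1 (Finset.mem_map.2 ⟨p, hp, rfl⟩) d hd)
    have : q' = q := Subtype.ext (he.trans hdq)
    exact this ▸ hq'

theorem fleetSize_map (C : Finset (S.active G)) :
    S.fleetSize G (C.map (Function.Embedding.subtype _)) =
      ∑ p ∈ C, a.meanTime p.1 * S.throughput p.1.1 p.1.2 := by
  rw [StaticSolution.fleetSize_eq, Finset.sum_map]
  refine Finset.sum_congr rfl fun p _ => ?_
  rw [FleetAction.meanTime, Finset.sum_mul]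
  refine Finset.sum_congr rfl fun d _ => ?_
  simp only [Function.Embedding.subtype_apply]
  rw [← ha.throughput_mul_decide p.2]
  ring

end FleetAction.RandomizesBy

end Flows

/-! ### Occupation frequencies of a single vehicle -/

section Path

variable {m : ℕ} {G : Network m} {N : ℕ}

/-- Node and energy level of a vehicle, present or upon arrival. -/
def SysState.position (s : SysState m N) (n : Fin N) : Fin m × ℤ :=
  ((s.veh n).node, (s.veh n).energy)

theorem SysState.position_next_of_available (s : SysState m N) (x : Outcome m N) (n : Fin N)
    (h : (s.veh n).remaining = 0) :
    (s.next G x).position n = (x.1 n).target G (s.position n) ∧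
      ((s.next G x).veh n).remaining + 1 = (x.1 n).time G (s.position n) := by
  have h1 := (x.1 n).one_le_time G (s.position n)
  revert h1
  simp only [SysState.position, SysState.next, Vehicle.next, h, if_true]
  cases x.1 n with
  | charge => exact fun _ => ⟨rfl, rfl⟩
  | route j =>
    simp only [Decision.time, Decision.target]
    exact fun h1 => ⟨trivial, by omega⟩

theorem SysState.position_next_of_travelling (s : SysState m N) (x : Outcome m N) (n : Fin N)
    (h : (s.veh n).remaining ≠ 0) :
    (s.next G x).position n = s.position n ∧
      ((s.next G x).veh n).remaining + 1 = (s.veh n).remaining := by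
  simp only [SysState.position, SysState.next, Vehicle.next, h, if_false, true_and]
  omega

theorem SysState.avail_eq [DecidableEq (Fin m × ℤ)] (s : SysState m N) (n : Fin N)
    (p : Fin m × ℤ) :
    s.avail n p = if (s.veh n).remaining = 0 then (if s.position n = p then 1 else 0) else 0 := by
  unfold SysState.avail SysState.position
  rw [ite_and]
  congr

theorem SysState.sum_mul_take (s : SysState m N) (x : Outcome m N) (n : Fin N)
    {P : Finset (Fin m × ℤ)} (hP : s.position n ∈ P) (f : Fin m × ℤ → Decision m → ℝ) :
    ∑ p ∈ P, ∑ d, f p d * s.take x n p d =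
      if (s.veh n).remaining = 0 then f (s.position n) (x.1 n) else 0 := by
  classical
  simp only [SysState.take, SysState.avail_eq]
  split_ifs with h
  · simp [hP]
  · simp

/-- Conservation law: the indicator of the position of a vehicle changes by arrivals at and
departures from that position. -/
theorem SysState.indicator_position_next [DecidableEq (Fin m × ℤ)] (s : SysState m N)
    (x : Outcome m N) (n : Fin N) {P : Finset (Fin m × ℤ)} (hP : s.position n ∈ P)
    (q : Fin m × ℤ) :
    (if (s.next G x).position n = q then (1 : ℝ) else 0) - (if s.position n = q then 1 else 0) =
      ∑ p ∈ P, ∑ d, (if d.target G p = q then 1 else 0) * s.take x n p d - s.avail n q := by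
  rw [s.sum_mul_take x n hP fun p d => if d.target G p = q then 1 else 0, SysState.avail_eq]
  by_cases h : (s.veh n).remaining = 0
  · rw [(s.position_next_of_available x n h).1]
    simp [h]
  · rw [(s.position_next_of_travelling x n h).1]
    simp [h]

/-- A decision adds the periods that it takes to the remaining time, and each period uses up one. -/
theorem SysState.remaining_next (s : SysState m N) (x : Outcome m N) (n : Fin N)
    {P : Finset (Fin m × ℤ)} (hP : s.position n ∈ P) :
    (((s.next G x).veh n).remaining : ℝ) - (s.veh n).remaining =
      ∑ p ∈ P, ∑ d, (d.time G p : ℝ) * s.take x n p d - 1 := by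
  rw [s.sum_mul_take x n hP fun p d => (d.time G p : ℝ)]
  by_cases h : (s.veh n).remaining = 0
  · rw [← (s.position_next_of_available x n h).2]
    simp [h]
  · have := (s.position_next_of_travelling (G := G) x n h).2
    rw [if_neg h, ← this]
    push_cast
    ring

/-- Visits to `q` and decisions that lead to `q` differ in number by at most one. -/
theorem sum_indicator_position [DecidableEq (Fin m × ℤ)] (s₀ : SysState m N)
    (o : ℕ → Outcome m N) (n : Fin N) {P : Finset (Fin m × ℤ)}
    (hP : ∀ t, (stateAt G s₀ o t).position n ∈ P) (q : Fin m × ℤ) (T : ℕ) :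
    |∑ t ∈ Finset.range T, (stateAt G s₀ o t).avail n q -
      ∑ p ∈ P, ∑ d, (if d.target G p = q then 1 else 0) *
        ∑ t ∈ Finset.range T, (stateAt G s₀ o t).take (o t) n p d| ≤ 1 := by
  have h := Finset.sum_range_sub
    (fun t => if (stateAt G s₀ o t).position n = q then (1 : ℝ) else 0) T
  have hstep : ∀ t, (if (stateAt G s₀ o (t + 1)).position n = q then (1 : ℝ) else 0) -
      (if (stateAt G s₀ o t).position n = q then 1 else 0) = _ := fun t =>
    (stateAt G s₀ o t).indicator_position_next (G := G) (o t) n (hP t) q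
  rw [Finset.sum_congr rfl fun t _ => hstep t, Finset.sum_sub_distrib, Finset.sum_comm] at h
  rw [abs_sub_comm]
  simp only [Finset.mul_sum]
  have h2 : ∀ p : Fin m × ℤ, ∑ t ∈ Finset.range T, ∑ d : Decision m,
      (if d.target G p = q then (1 : ℝ) else 0) * (stateAt G s₀ o t).take (o t) n p d =
      ∑ d : Decision m, ∑ t ∈ Finset.range T,
        (if d.target G p = q then (1 : ℝ) else 0) * (stateAt G s₀ o t).take (o t) n p d :=
    fun p => Finset.sum_comm
  simp only [h2] at h
  rw [h, abs_le]
  split_ifs <;> constructor <;> norm_num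

/-- The decisions taken up to time `T` fill the time `T`, up to a bounded error from the trips that
are under way at the beginning and at the end. -/
theorem sum_time_take (s₀ : SysState m N)
    (o : ℕ → Outcome m N) (n : Fin N) {P : Finset (Fin m × ℤ)}
    (hP : ∀ t, (stateAt G s₀ o t).position n ∈ P) (T : ℕ) :
    |∑ p ∈ P, ∑ d : Decision m, (d.time G p : ℝ) *
        ∑ t ∈ Finset.range T, (stateAt G s₀ o t).take (o t) n p d - T| ≤
      (s₀.veh n).remaining + ∑ p ∈ P, ∑ d : Decision m, (d.time G p : ℝ) := by
  have hrem : ∀ t, (((stateAt G s₀ o t).veh n).remaining : ℝ) ≤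
      (s₀.veh n).remaining + ∑ p ∈ P, ∑ d : Decision m, (d.time G p : ℝ) := by
    intro t
    have hnn : ∀ p : Fin m × ℤ, 0 ≤ ∑ d : Decision m, (d.time G p : ℝ) := fun p =>
      Finset.sum_nonneg fun d _ => Nat.cast_nonneg _
    induction t with
    | zero =>
      simp only [stateAt]
      linarith [Finset.sum_nonneg fun p (_ : p ∈ P) => hnn p]
    | succ t ih =>
      simp only [stateAt]
      by_cases h : ((stateAt G s₀ o t).veh n).remaining = 0
      · have h1 := ((stateAt G s₀ o t).position_next_of_available (G := G) (o t) n h).2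
        have h2 : (((o t).1 n).time G ((stateAt G s₀ o t).position n) : ℝ) ≤
            ∑ p ∈ P, ∑ d : Decision m, (d.time G p : ℝ) :=
          (Finset.single_le_sum (f := fun d : Decision m =>
            (d.time G ((stateAt G s₀ o t).position n) : ℝ))
            (fun d _ => Nat.cast_nonneg _) (Finset.mem_univ _)).trans
            (Finset.single_le_sum (f := fun p => ∑ d : Decision m, (d.time G p : ℝ))
              (fun p _ => hnn p) (hP t))
        rw [← h1] at h2
        push_cast at h2
        have : (0 : ℝ) ≤ (s₀.veh n).remaining := Nat.cast_nonneg _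
        linarith
      · have h1 := ((stateAt G s₀ o t).position_next_of_travelling (G := G) (o t) n h).2
        rw [← h1] at ih
        push_cast at ih
        linarith
  have h := Finset.sum_range_sub (fun t => (((stateAt G s₀ o t).veh n).remaining : ℝ)) T
  have hT := hrem T
  simp only [stateAt] at h
  rw [Finset.sum_congr rfl fun t _ =>
    (stateAt G s₀ o t).remaining_next (G := G) (o t) n (hP t),
    Finset.sum_sub_distrib, Finset.sum_comm] at h
  have h2 : ∀ p : Fin m × ℤ, ∑ t ∈ Finset.range T, ∑ d : Decision m,
      (d.time G p : ℝ) * (stateAt G s₀ o t).take (o t) n p d =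
      ∑ d : Decision m, ∑ t ∈ Finset.range T,
        (d.time G p : ℝ) * (stateAt G s₀ o t).take (o t) n p d :=
    fun p => Finset.sum_comm
  simp only [h2, Finset.sum_const, Finset.card_range, nsmul_eq_mul, mul_one] at h
  simp only [Finset.mul_sum]
  rw [h, abs_le]
  have h3 : (0 : ℝ) ≤ (s₀.veh n).remaining := Nat.cast_nonneg _
  have h4 : (0 : ℝ) ≤ ((stateAt G s₀ o T).veh n).remaining := Nat.cast_nonneg _
  have h5 : 0 ≤ ∑ p ∈ P, ∑ d : Decision m, (d.time G p : ℝ) :=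
    Finset.sum_nonneg fun p _ => Finset.sum_nonneg fun d _ => Nat.cast_nonneg _
  constructor <;> linarith

/-- The properties of a sequence of outcomes, valid almost surely, from which the behaviour of the
vehicles follows: decisions of probability zero are not taken, and in the long run the decisions
taken at `p` have the prescribed frequencies. -/
structure TypicalDecisions (a : FleetAction G) (s₀ : SysState m N) (o : ℕ → Outcome m N) : Prop where
  ne_zero : ∀ t n, a.decide ((stateAt G s₀ o t).veh n).node ((stateAt G s₀ o t).veh n).energy
    ((o t).1 n) ≠ 0
  average : ∀ n p d, Tendsto (fun T : ℕ =>
      (∑ t ∈ Finset.range T, ((stateAt G s₀ o t).take (o t) n p d -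
        (stateAt G s₀ o t).avail n p * (a.decide p.1 p.2 d).toReal)) / (T : ℝ)) atTop (𝓝 0)

variable {S : StaticSolution m} {a : FleetAction G} {s₀ : SysState m N} {o : ℕ → Outcome m N}

/-- A vehicle never leaves a closed set of active positions. -/
theorem TypicalDecisions.position_mem (ho : TypicalDecisions a s₀ o) (ha : a.RandomizesBy S)
    {n : Fin N} {C : Finset (S.active G)} (hC : IsClosedFor (a.transition S) C)
    (hS : S.Feasible G)
    (h0 : s₀.position n ∈ C.map (Function.Embedding.subtype _)) (t : ℕ) :
    (stateAt G s₀ o t).position n ∈ C.map (Function.Embedding.subtype _) := by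
  rw [ha.isClosedFor_iff hS, StaticSolution.isClosed_iff] at hC
  induction t with
  | zero => exact h0
  | succ t ih =>
    simp only [stateAt]
    by_cases h : ((stateAt G s₀ o t).veh n).remaining = 0
    · rw [((stateAt G s₀ o t).position_next_of_available (o t) n h).1]
      have hact : (stateAt G s₀ o t).position n ∈ S.active G := by
        obtain ⟨q, -, hq⟩ := Finset.mem_map.1 ih
        exact hq ▸ q.2
      exact hC _ ih _ (ha.flow_pos hact (ho.ne_zero t n))
    · rw [((stateAt G s₀ o t).position_next_of_travelling (o t) n h).1]
      exact ih

theorem tendsto_div_of_abs_sub_le {f g : ℕ → ℝ} {K : ℝ} (h : ∀ T, |f T - g T| ≤ K) :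
    Tendsto (fun T : ℕ => f T / T - g T / T) atTop (𝓝 0) := by
  refine squeeze_zero_norm (a := fun T : ℕ => K / T) (fun T => ?_)
    (tendsto_const_div_atTop_nhds_zero_nat K)
  rw [Real.norm_eq_abs, ← sub_div, abs_div, Nat.abs_cast]
  exact div_le_div_of_nonneg_right (h T) (Nat.cast_nonneg T)

open Classical in
/-- Ergodic theorem for a single vehicle that starts at an active position: its occupation
frequencies converge to an invariant vector. On a closed set, the limit weighted by the mean time
per decision has mass one or zero, according to whether the vehicle starts there. -/
theorem TypicalDecisions.exists_tendsto_occupation (ho : TypicalDecisions a s₀ o)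
    (ha : a.RandomizesBy S) (hS : S.Feasible G) {n : Fin N} (h0 : s₀.position n ∈ S.active G) :
    ∃ w : S.active G → ℝ,
      (∀ p : S.active G, Tendsto (fun T : ℕ =>
        (∑ t ∈ Finset.range T, (stateAt G s₀ o t).avail n p) / (T : ℝ)) atTop (𝓝 (w p))) ∧
      (∀ q, ∑ p, w p * a.transition S p q = w q) ∧
      ∀ C, IsClosedFor (a.transition S) C → ∑ p ∈ C, a.meanTime p.1 * w p =
        if s₀.position n ∈ C.map (Function.Embedding.subtype _) then 1 else 0 := by
  set u : ℕ → Fin m × ℤ → ℝ := fun T p =>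
    (∑ t ∈ Finset.range T, (stateAt G s₀ o t).avail n p) / (T : ℝ) with hu
  set r : ℕ → Fin m × ℤ → Decision m → ℝ := fun T p d =>
    (∑ t ∈ Finset.range T, (stateAt G s₀ o t).take (o t) n p d) / (T : ℝ) with hr
  have hru : ∀ p d, Tendsto (fun T => r T p d - u T p * (a.decide p.1 p.2 d).toReal) atTop
      (𝓝 0) := fun p d => by
    refine (ho.average n p d).congr fun T => ?_
    simp only [hu, hr]
    rw [Finset.sum_sub_distrib, ← Finset.sum_mul]
    ring
  -- replace decision frequencies by occupation frequencies in a weighted sum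
  have hcomb : ∀ (P : Finset (Fin m × ℤ)) (f : Fin m × ℤ → Decision m → ℝ),
      Tendsto (fun T => ∑ p ∈ P, ∑ d, f p d * r T p d -
        ∑ p ∈ P, ∑ d, f p d * (u T p * (a.decide p.1 p.2 d).toReal)) atTop (𝓝 0) := by
    intro P f
    have h : Tendsto (fun T => ∑ p ∈ P, ∑ d, f p d *
        (r T p d - u T p * (a.decide p.1 p.2 d).toReal)) atTop
        (𝓝 (∑ p ∈ P, ∑ d, f p d * 0)) :=
      tendsto_finsetSum _ fun p _ => tendsto_finsetSum _ fun d _ => (hru p d).const_mul _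
    simp only [mul_zero, Finset.sum_const_zero] at h
    refine h.congr fun T => ?_
    simp only [mul_sub, Finset.sum_sub_distrib]
  have huniv : IsClosedFor (a.transition S) Finset.univ := fun _ _ _ _ => Finset.mem_univ _
  have hmem : ∀ t, (stateAt G s₀ o t).position n ∈ S.active G := fun t => by
    obtain ⟨q, -, hq⟩ := Finset.mem_map.1
      (ho.position_mem ha huniv hS (Finset.mem_map.2 ⟨⟨_, h0⟩, Finset.mem_univ _, rfl⟩) t)
    exact hq ▸ q.2
  obtain ⟨w, hw, hinv, hC⟩ := exists_tendsto_of_asymptotically_invariant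
    (Q := a.transition S) (D := fun p => a.meanTime p.1) (u := fun T p => u T p.1)
    (c := fun C => if s₀.position n ∈ C.map (Function.Embedding.subtype _) then 1 else 0)
    a.transition_nonneg (ha.transition_row hS) (fun p => a.meanTime_pos p.1)
    (fun q => by
      have h1 := (tendsto_div_of_abs_sub_le (sum_indicator_position s₀ o n hmem q.1)).add
        (hcomb (S.active G) fun p d => if d.target G p = q.1 then 1 else 0)
      rw [add_zero] at h1
      refine h1.congr fun T => ?_
      have e1 : ∑ p : S.active G, u T p.1 * a.transition S p q =
          ∑ p ∈ S.active G, ∑ d : Decision m, (if d.target G p = q.1 then 1 else 0) *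
            (u T p * (a.decide p.1 p.2 d).toReal) := by
        rw [← Finset.sum_coe_sort (S.active G) fun p => ∑ d : Decision m,
          (if d.target G p = q.1 then 1 else 0) * (u T p * (a.decide p.1 p.2 d).toReal)]
        refine Finset.sum_congr rfl fun p _ => ?_
        rw [FleetAction.transition, Finset.mul_sum]
        refine Finset.sum_congr rfl fun d _ => ?_
        split_ifs <;> ring
      have e2 : (∑ p ∈ S.active G, ∑ d : Decision m, (if d.target G p = q.1 then 1 else 0) *
          ∑ t ∈ Finset.range T, (stateAt G s₀ o t).take (o t) n p d) / (T : ℝ) =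
          ∑ p ∈ S.active G, ∑ d : Decision m, (if d.target G p = q.1 then 1 else 0) *
            r T p d := by
        simp only [hr, Finset.sum_div, mul_div_assoc]
      rw [e1, e2]
      simp only [hu]
      ring)
    (fun C hC => by
      by_cases hn : s₀.position n ∈ C.map (Function.Embedding.subtype _)
      · rw [if_pos hn]
        have hmC := ho.position_mem ha hC hS hn
        have h1 := (tendsto_div_of_abs_sub_le (sum_time_take s₀ o n hmC)).sub
          (hcomb (C.map (Function.Embedding.subtype _)) fun p d => (d.time G p : ℝ))
        have h2 := h1.add_const 1
        rw [sub_zero, zero_add] at h2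
        refine h2.congr' ?_
        filter_upwards [eventually_gt_atTop 0] with T hT
        have hT0 : (T : ℝ) ≠ 0 := by positivity
        have e1 : ∑ p ∈ C, a.meanTime p.1 * u T p.1 =
            ∑ p ∈ C.map (Function.Embedding.subtype _), ∑ d : Decision m,
              (d.time G p : ℝ) * (u T p * (a.decide p.1 p.2 d).toReal) := by
          rw [Finset.sum_map]
          refine Finset.sum_congr rfl fun p _ => ?_
          rw [FleetAction.meanTime, Finset.sum_mul]
          refine Finset.sum_congr rfl fun d _ => ?_
          simp only [Function.Embedding.subtype_apply]
          ring
        have e2 : (∑ p ∈ C.map (Function.Embedding.subtype _), ∑ d : Decision m,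
            (d.time G p : ℝ) *
              ∑ t ∈ Finset.range T, (stateAt G s₀ o t).take (o t) n p d) / (T : ℝ) =
            ∑ p ∈ C.map (Function.Embedding.subtype _), ∑ d : Decision m,
              (d.time G p : ℝ) * r T p d := by
          simp only [hr, Finset.sum_div, mul_div_assoc]
        rw [e1, e2, div_self hT0]
        ring
      · rw [if_neg hn]
        -- a vehicle that starts outside of `C` stays in the complement, which is closed too
        have hCc := hC.compl a.transition_nonneg (ha.transition_row hS)
          (fun p => (StaticSolution.mem_active.1 p.2).2) (ha.transition_invariant hS)
        have hn' : s₀.position n ∈ Cᶜ.map (Function.Embedding.subtype _) :=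
          Finset.mem_map.2 ⟨⟨_, h0⟩, Finset.mem_compl.2 fun h =>
            hn (Finset.mem_map.2 ⟨_, h, rfl⟩), rfl⟩
        have hzero : ∀ p ∈ C, ∀ t, (stateAt G s₀ o t).avail n p.1 = 0 := fun p hp t => by
          rw [SysState.avail_eq]
          have hne : (stateAt G s₀ o t).position n ≠ p.1 := fun he => by
            obtain ⟨q, hq, hqe⟩ := Finset.mem_map.1 (ho.position_mem ha hCc hS hn' t)
            have : q = p := Subtype.ext (hqe.trans he)
            exact Finset.mem_compl.1 hq (this ▸ hp)
          simp [hne]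
        refine tendsto_const_nhds.congr fun T => ?_
        refine (Finset.sum_eq_zero fun p hp => ?_).symm
        simp only [hu]
        rw [Finset.sum_eq_zero fun t _ => hzero p hp t]
        simp)
  exact ⟨w, fun p => tendsto_pi_nhds.1 hw p, hinv, hC⟩

end Path

/-! ### The fleet -/

section Fleet

variable {m : ℕ} {G : Network m} {N : ℕ} {S : StaticSolution m} {a : FleetAction G}
  {s₀ : SysState m N} {o : ℕ → Outcome m N}

/-- The vehicles that start at, or on their way to, an active position. -/
noncomputable def SysState.activeVehicles (s : SysState m N) (G : Network m)
    (S : StaticSolution m) : Finset (Fin N) :=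
  Finset.univ.filter fun n => s.position n ∈ S.active G

/-- The joint occupation frequencies of the active vehicles converge to an invariant vector that
gives each closed set the number of vehicles that start there. -/
theorem TypicalDecisions.exists_fleet_occupation (ho : TypicalDecisions a s₀ o)
    (ha : a.RandomizesBy S) (hS : S.Feasible G) :
    ∃ w : S.active G → ℝ,
      (∀ p : S.active G, Tendsto (fun T : ℕ => ∑ n ∈ s₀.activeVehicles G S,
        (∑ t ∈ Finset.range T, (stateAt G s₀ o t).avail n p) / (T : ℝ)) atTop (𝓝 (w p))) ∧
      (∀ q, ∑ p, w p * a.transition S p q = w q) ∧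
      ∀ C, IsClosedFor (a.transition S) C → ∑ p ∈ C, a.meanTime p.1 * w p =
        s₀.count (C.map (Function.Embedding.subtype _)) := by
  have h : ∀ n : Fin N, ∃ w : S.active G → ℝ, n ∈ s₀.activeVehicles G S → _ := fun n => by
    by_cases hn : s₀.position n ∈ S.active G
    · obtain ⟨w, hw⟩ := ho.exists_tendsto_occupation ha hS hn
      exact ⟨w, fun _ => hw⟩
    · exact ⟨0, fun h => absurd (Finset.mem_filter.1 h).2 hn⟩
  choose w hw using h
  refine ⟨fun p => ∑ n ∈ s₀.activeVehicles G S, w n p,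
    fun p => tendsto_finsetSum _ fun n hn => (hw n hn).1 p, fun q => ?_, fun C hC => ?_⟩
  · simp only [Finset.sum_mul]
    rw [Finset.sum_comm]
    exact Finset.sum_congr rfl fun n hn => (hw n hn).2.1 q
  · simp only [Finset.mul_sum]
    rw [Finset.sum_comm, Finset.sum_congr rfl fun n hn => (hw n hn).2.2 C hC,
      Finset.sum_boole, SysState.count]
    congr 2
    ext n
    simp only [SysState.activeVehicles, Finset.mem_filter, Finset.mem_univ, true_and]
    refine and_iff_right_of_imp fun h => ?_
    obtain ⟨q, -, hq⟩ := Finset.mem_map.1 h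
    exact hq ▸ q.2

/-- Long-run frequencies of the decisions taken by the active vehicles: at least the static flows
if the initial fleet covers the static solution, and equal to them if it matches. -/
theorem TypicalDecisions.exists_tendsto_decisions (ho : TypicalDecisions a s₀ o)
    (ha : a.RandomizesBy S) (hS : S.Feasible G) (hcov : s₀.FleetCovers G S) :
    ∃ b : Fin m × ℤ → Decision m → ℝ,
      (∀ p d, Tendsto (fun T : ℕ => (∑ t ∈ Finset.range T, ∑ n ∈ s₀.activeVehicles G S,
        (stateAt G s₀ o t).take (o t) n p d) / (T : ℝ)) atTop (𝓝 (b p d))) ∧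
      (∀ p d, S.flow p d ≤ b p d) ∧ (s₀.FleetMatches G S → ∀ p d, b p d = S.flow p d) := by
  classical
  obtain ⟨w, hw, hinv, hC⟩ := ho.exists_fleet_occupation ha hS
  have hinv' := ha.transition_invariant hS
  have hge : ∀ p : S.active G, S.throughput p.1.1 p.1.2 ≤ w p := fun p => by
    have := nonneg_of_invariant (w := fun p => w p - S.throughput p.1.1 p.1.2)
      a.transition_nonneg (ha.transition_row hS) (D := fun p => a.meanTime p.1)
      (fun p => a.meanTime_pos p.1)
      (fun q => by simp only [sub_mul, Finset.sum_sub_distrib, hinv q, hinv' q])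
      (fun C hCl => by
        simp only [mul_sub, Finset.sum_sub_distrib]
        rw [hC C hCl, ← ha.fleetSize_map, sub_nonneg]
        exact hcov _ ((ha.isClosedFor_iff hS).1 hCl)) p
    linarith
  have hle : s₀.FleetMatches G S → ∀ p : S.active G, w p ≤ S.throughput p.1.1 p.1.2 :=
      fun hm p => by
    have := nonneg_of_invariant (w := fun p => S.throughput p.1.1 p.1.2 - w p)
      a.transition_nonneg (ha.transition_row hS) (D := fun p => a.meanTime p.1)
      (fun p => a.meanTime_pos p.1)
      (fun q => by simp only [sub_mul, Finset.sum_sub_distrib, hinv q, hinv' q])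
      (fun C hCl => by
        simp only [mul_sub, Finset.sum_sub_distrib]
        rw [hC C hCl, ← ha.fleetSize_map, sub_nonneg]
        exact (hm _ ((ha.isClosedFor_iff hS).1 hCl)).le) p
    linarith
  refine ⟨fun p d => if h : p ∈ S.active G then w ⟨p, h⟩ * (a.decide p.1 p.2 d).toReal else 0,
    fun p d => ?_, fun p d => ?_, fun hm p d => ?_⟩
  · by_cases hp : p ∈ S.active G
    · simp only [dif_pos hp]
      have h1 : Tendsto (fun T : ℕ => ∑ n ∈ s₀.activeVehicles G S,
          (∑ t ∈ Finset.range T, ((stateAt G s₀ o t).take (o t) n p d -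
            (stateAt G s₀ o t).avail n p * (a.decide p.1 p.2 d).toReal)) / (T : ℝ)) atTop
          (𝓝 (∑ n ∈ s₀.activeVehicles G S, 0)) :=
        tendsto_finsetSum _ fun n _ => ho.average n p d
      have h2 := h1.add ((hw ⟨p, hp⟩).mul_const (a.decide p.1 p.2 d).toReal)
      rw [Finset.sum_const_zero, zero_add] at h2
      refine h2.congr fun T => ?_
      rw [Finset.sum_mul, ← Finset.sum_add_distrib, Finset.sum_comm, Finset.sum_div]
      refine Finset.sum_congr rfl fun n _ => ?_
      rw [Finset.sum_sub_distrib, ← Finset.sum_mul]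
      ring
    · simp only [dif_neg hp]
      refine tendsto_const_nhds.congr fun T => ?_
      rw [Finset.sum_eq_zero, zero_div]
      refine fun t _ => Finset.sum_eq_zero fun n hn => ?_
      have huniv : IsClosedFor (a.transition S) Finset.univ := fun _ _ _ _ => Finset.mem_univ _
      have h0 := (Finset.mem_filter.1 hn).2
      obtain ⟨q, -, hq⟩ := Finset.mem_map.1
        (ho.position_mem ha huniv hS (Finset.mem_map.2 ⟨⟨_, h0⟩, Finset.mem_univ _, rfl⟩) t)
      have hne : (stateAt G s₀ o t).position n ≠ p := fun he => hp (he ▸ hq ▸ q.2)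
      simp [SysState.take, SysState.avail_eq, hne]
  · simp only
    split_ifs with hp
    · rw [← ha.throughput_mul_decide hp]
      exact mul_le_mul_of_nonneg_right (hge ⟨p, hp⟩) ENNReal.toReal_nonneg
    · exact (hS.flow_eq_zero hp d).le
  · simp only
    split_ifs with hp
    · rw [← ha.throughput_mul_decide hp, le_antisymm (hle hm ⟨p, hp⟩) (hge ⟨p, hp⟩)]
    · exact (hS.flow_eq_zero hp d).symm

/-- In a matching fleet all vehicles are active: a position without flow is closed by itself. -/
theorem SysState.FleetMatches.activeVehicles_eq (hS : S.Feasible G) (hm : s₀.FleetMatches G S) :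
    s₀.activeVehicles G S = Finset.univ := by
  rw [SysState.activeVehicles, Finset.filter_eq_self]
  intro n _
  by_contra hn
  have h1 := hm {s₀.position n} (StaticSolution.isClosed_iff.2 fun p hp d hd => by
    rw [Finset.mem_singleton] at hp
    rw [hp, hS.flow_eq_zero hn] at hd
    exact absurd hd (lt_irrefl _))
  rw [StaticSolution.fleetSize_eq, Finset.sum_singleton] at h1
  simp only [hS.flow_eq_zero hn, mul_zero, Finset.sum_const_zero, Nat.cast_eq_zero,
    SysState.count, Finset.card_eq_zero] at h1
  have : n ∈ (∅ : Finset (Fin N)) := by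
    rw [← h1]
    simp [SysState.position]
  simp at this

/-- Number of vehicles in `V` that are routed from `i` to `j` in a period. -/
noncomputable def routedOf (G : Network m) (V : Finset (Fin N)) (s : SysState m N)
    (x : Outcome m N) (i j : Fin m) : ℕ :=
  ∑ v ∈ Finset.Icc (G.energyUse i j : ℤ) (G.vmax : ℤ), (V.filter fun n : Fin N =>
    (s.veh n).remaining = 0 ∧ (s.veh n).node = i ∧ (s.veh n).energy = v ∧
      x.1 n = Decision.route j).card

theorem routedOf_le (V : Finset (Fin N)) (s : SysState m N) (x : Outcome m N) (i j : Fin m) :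
    routedOf G V s x i j ≤ routed G s x i j :=
  Finset.sum_le_sum fun _ _ => Finset.card_le_card
    (Finset.filter_subset_filter _ (Finset.subset_univ _))

theorem cast_routedOf (V : Finset (Fin N)) (s : SysState m N) (x : Outcome m N) (i j : Fin m) :
    (routedOf G V s x i j : ℝ) = ∑ v ∈ Finset.Icc (G.energyUse i j : ℤ) (G.vmax : ℤ),
      ∑ n ∈ V, s.take x n (i, v) (Decision.route j) := by
  rw [routedOf, Nat.cast_sum]
  refine Finset.sum_congr rfl fun v _ => ?_
  rw [← Finset.sum_boole]
  refine Finset.sum_congr rfl fun n _ => ?_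
  rw [SysState.take, SysState.avail, ite_zero_mul_ite_zero, mul_one]
  simp only [Prod.mk.injEq, and_assoc]

theorem TypicalDecisions.exists_tendsto_routed (ho : TypicalDecisions a s₀ o)
    (ha : a.RandomizesBy S) (hS : S.Feasible G) (hcov : s₀.FleetCovers G S) (i j : Fin m) :
    ∃ β : ℝ, Tendsto (fun T : ℕ => (∑ t ∈ Finset.range T,
        (routedOf G (s₀.activeVehicles G S) (stateAt G s₀ o t) (o t) i j : ℝ)) / T) atTop (𝓝 β) ∧
      S.routedFlow G i j ≤ β ∧ (s₀.FleetMatches G S → β = S.routedFlow G i j) := by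
  obtain ⟨b, hb, hge, heq⟩ := ho.exists_tendsto_decisions ha hS hcov
  refine ⟨∑ v ∈ Finset.Icc (G.energyUse i j : ℤ) (G.vmax : ℤ), b (i, v) (Decision.route j), ?_,
    Finset.sum_le_sum fun v _ => hge (i, v) (Decision.route j),
    fun hm => Finset.sum_congr rfl fun v _ => heq hm (i, v) (Decision.route j)⟩
  refine (tendsto_finsetSum _ fun v _ => hb (i, v) (Decision.route j)).congr fun T => ?_
  simp only [cast_routedOf]
  rw [Finset.sum_comm, Finset.sum_div]

end Fleet

section Main

variable {m : ℕ} {G : Network m} {N : ℕ} {S : StaticSolution m} {a : FleetAction G}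

theorem ae_typicalDecisions (a : FleetAction G) (s₀ : SysState m N) :
    ∀ᵐ o ∂(Policy.static N a).law s₀, TypicalDecisions a s₀ o := by
  have h : ∀ᵐ o ∂(Policy.static N a).law s₀, ∀ (n : Fin N) (p : Fin m × ℤ) (d : Decision m), _ :=
    ae_all_iff.2 fun n => ae_all_iff.2 fun p => ae_all_iff.2 fun d =>
      ae_tendsto_decisions a s₀ n p d
  filter_upwards [ae_forall_decide_ne_zero a s₀, h] with o h1 h2
  exact ⟨h1, h2⟩

theorem StaticSolution.Feasible.exists_randomizesBy (hS : S.Feasible G) :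
    ∃ a : FleetAction G, a.RandomizesBy S := by
  classical
  have hsum : ∀ p : Fin m × ℤ, p ∈ S.active G →
      ∑ d : Decision m, ENNReal.ofReal (S.flow p d / S.throughput p.1 p.2) = 1 := fun p hp => by
    have hpos := (StaticSolution.mem_active.1 hp).2
    rw [← ENNReal.ofReal_sum_of_nonneg fun d _ => div_nonneg (hS.flow_nonneg p d) hpos.le,
      ← Finset.sum_div, ← S.throughput_eq, div_self hpos.ne', ENNReal.ofReal_one]
  -- at positions without flow, vehicles stay idle
  let q : Fin m → ℤ → PMF (Decision m) := fun i v =>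
    if h : (i, v) ∈ S.active G then PMF.ofFintype _ (hsum (i, v) h)
    else PMF.pure (Decision.route i)
  have hq : ∀ i v, (i, v) ∈ S.active G → ∀ d,
      q i v d = ENNReal.ofReal (S.flow (i, v) d / S.throughput i v) := fun i v h d => by
    simp only [q, dif_pos h, PMF.ofFintype_apply]
  refine ⟨⟨S.price, q, fun i => ?_, fun i j v hv hlt => ?_⟩, fun _ _ => rfl,
    fun i v hv hne => ?_⟩
  · by_cases h : (i, (G.vmax : ℤ)) ∈ S.active G
    · rw [hq _ _ h, StaticSolution.flow, hS.full i]
      simp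
    · simp only [q, dif_neg h]
      exact PMF.pure_apply_of_ne _ _ (by simp)
  · by_cases h : (i, v) ∈ S.active G
    · rw [hq _ _ h, StaticSolution.flow, hS.enough i j v hlt]
      simp
    · simp only [q, dif_neg h]
      refine PMF.pure_apply_of_ne _ _ fun he => ?_
      rw [Decision.route.injEq] at he
      rw [he, G.energyUse_self] at hlt
      exact absurd (Network.mem_levels.1 hv).1 (not_le.2 (by simpa using hlt))
  · have hnn := hS.throughput_nonneg (i, v)
    have h : (i, v) ∈ S.active G :=
      StaticSolution.mem_active.2 ⟨hv, lt_of_le_of_ne hnn (Ne.symm hne)⟩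
    have hreal : ∀ d, (q i v d).toReal = S.flow (i, v) d / S.throughput i v := fun d => by
      rw [hq i v h, ENNReal.toReal_ofReal (div_nonneg (hS.flow_nonneg _ d) hnn)]
    exact ⟨fun j => hreal _, hreal _⟩

theorem StaticSolution.Feasible.exists_fleetCovers (hS : S.Feasible G) :
    ∃ (N : ℕ) (s₀ : SysState m N), s₀.Valid G ∧ s₀.FleetCovers G S := by
  classical
  have hnn : ∀ p : Fin m × ℤ, 0 ≤ ∑ d : Decision m, (d.time G p : ℝ) * S.flow p d := fun p =>
    Finset.sum_nonneg fun d _ => mul_nonneg (Nat.cast_nonneg _) (hS.flow_nonneg p d)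
  -- at each active position, enough vehicles for the entire static flow
  set K := ⌈S.fleetSize G (S.active G)⌉₊ with hK
  let e := Fintype.equivFin (S.active G × Fin K)
  refine ⟨Fintype.card (S.active G × Fin K),
    ⟨fun _ _ => 0, fun n => ⟨(e.symm n).1.1.1, (e.symm n).1.1.2, 0⟩⟩, fun n => ?_, fun C _ => ?_⟩
  · exact (StaticSolution.mem_active.1 (e.symm n).1.2).1
  · have hC : S.fleetSize G C = S.fleetSize G (C.filter (· ∈ S.active G)) := by
      rw [StaticSolution.fleetSize_eq, StaticSolution.fleetSize_eq]
      refine (Finset.sum_subset (Finset.filter_subset _ _) fun p hp hp' => ?_).symm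
      have : p ∉ S.active G := fun h => hp' (Finset.mem_filter.2 ⟨hp, h⟩)
      simp [hS.flow_eq_zero this]
    rw [hC]
    rcases (C.filter (· ∈ S.active G)).eq_empty_or_nonempty with h0 | ⟨p, hp⟩
    · rw [h0, StaticSolution.fleetSize_eq, Finset.sum_empty]
      exact Nat.cast_nonneg _
    · have h1 : S.fleetSize G (C.filter (· ∈ S.active G)) ≤ S.fleetSize G (S.active G) := by
        rw [StaticSolution.fleetSize_eq, StaticSolution.fleetSize_eq]
        exact Finset.sum_le_sum_of_subset_of_nonneg
          (fun q hq => (Finset.mem_filter.1 hq).2) fun q _ _ => hnn q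
      refine (h1.trans (Nat.le_ceil _)).trans (Nat.cast_le.2 ?_)
      rw [Finset.mem_filter] at hp
      have hcard : K = (Finset.univ : Finset (Fin K)).card := (Finset.card_fin K).symm
      refine hcard.le.trans (Finset.card_le_card_of_injOn (fun k => e (⟨p, hp.2⟩, k)) (fun k _ => ?_)
        fun k _ l _ h => ?_)
      · simp [hp.1]
      · simpa using h

end Main

theorem corollary1p1 {m : ℕ} (G : Network m) (S : StaticSolution m) (hS : S.Feasible G) :
    (∃ a : FleetAction G, a.RandomizesBy S) ∧
    (∃ (N : ℕ) (s₀ : SysState m N), s₀.Valid G ∧ s₀.FleetCovers G S) ∧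
    ∀ a : FleetAction G, a.RandomizesBy S →
      ∀ (N : ℕ) (s₀ : SysState m N), s₀.Valid G →
        (s₀.FleetMatches G S →
          MeetsCriteria S (Policy.static N a) s₀ ∧ RateStable (Policy.static N a) s₀) ∧
        (s₀.FleetCovers G S → RateStable (Policy.static N a) s₀) := by
  refine ⟨hS.exists_randomizesBy, hS.exists_fleetCovers, fun a ha N s₀ _ => ?_⟩
  have hstable : s₀.FleetCovers G S → RateStable (Policy.static N a) s₀ := by
    intro hcov i j
    filter_upwards [ae_typicalDecisions a s₀, ae_tendsto_requests a s₀ i j] with o ho hA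
    obtain ⟨β, hβ, hge, -⟩ := ho.exists_tendsto_routed ha hS hcov i j
    rw [ha.1 i j] at hA
    exact tendsto_queue_div_zero (fun t => rfl) (fun t => routedOf_le _ _ _ i j)
      ((hS.demand i j).trans hge) hA hβ
  have hcov : s₀.FleetMatches G S → s₀.FleetCovers G S := fun hm C hC => (hm C hC).ge
  refine ⟨fun hm => ⟨fun i j => ?_, hstable (hcov hm)⟩, hstable⟩
  filter_upwards [ae_typicalDecisions a s₀, ae_tendsto_requests a s₀ i j] with o ho hA
  obtain ⟨β, hβ, -, heq⟩ := ho.exists_tendsto_routed ha hS (hcov hm) i j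
  rw [ha.1 i j] at hA
  rw [heq hm, hm.activeVehicles_eq hS] at hβ
  -- `routedOf` of all vehicles is `routed` by definition
  exact ⟨hA, hβ⟩
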